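/- Let $\mathbb{B}^m \subset \mathbb{C}^m$ be the open unit ball and let $M$ be a connected complex manifold of dimension $m$ (Hausdorff and second countable). For $\zeta \in M$ let $\mathrm{wsq}_M(\zeta) \in [0,1]$ be the supremum of all $s \in [0,1]$ for which there exist a holomorphic embedding $\Phi : \mathbb{B}^m \to M$ and a $C^2$ function $\phi : M \to [0,1]$ such that $\Phi(0) = \zeta$, $\phi(\zeta) = 0$, $\log \phi : M \to [-\infty, 0]$ is plurisubharmonic, and $$\mathscr{L}(\phi \circ \Phi) \geq s^2 g_{\mathrm{Euc}} \quad \text{on } \mathbb{B}^m$$ (with $\sup \emptyset = 0$). Here $\mathscr{L}(f) = \sum_{j,k} \frac{\partial^2 f}{\partial z^j \partial \bar z^k}\, dz^j \otimes d\bar z^k$ is the Levi form and $g_{\mathrm{Euc}} = \sum_j dz^j \otimes d\bar z^j$ is the Euclidean metric. Recall that $M$ is taut if every sequence of holomorphic maps from the unit disc $\mathbb{D} \subset \mathbb{C}$ to $M$ has a subsequence that either converges uniformly on compact sets to a holomorphic map $\mathbb{D} \to M$ or is compactly divergent. Proposition. If $M$ is taut and $\mathrm{wsq}_M(z) = 1$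 for some $z \in M$, then $M$ is biholomorphic to $\mathbb{B}^m$. -/

import Mathlib

open scoped Manifold ContDiff ENNReal

noncomputable section

/-- The model space `ℂ^m` with its Euclidean (Hermitian) norm. -/
abbrev Cn (m : ℕ) : Type := EuclideanSpace ℂ (Fin m)

/-- The open unit ball `𝔹^m` of `ℂ^m`, as an open submanifold of `ℂ^m`. -/
def unitBall (m : ℕ) : TopologicalSpace.Opens (Cn m) :=
  ⟨Metric.ball (0 : Cn m) 1, Metric.isOpen_ball⟩

/-- The open unit disc of `ℂ`. -/
def unitDisc : Set ℂ := Metric.ball (0 : ℂ) 1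

/-! ### Wirtinger derivatives and the Levi form on `ℂ^m` -/

/-- `∂F/∂z^j = (∂F/∂x^j - i ∂F/∂y^j) / 2`, where `z^j = x^j + i y^j`. -/
def wirtingerZ {m : ℕ} (j : Fin m) (F : Cn m → ℂ) (w : Cn m) : ℂ :=
  (fderiv ℝ F w (EuclideanSpace.single j 1)
    - Complex.I * fderiv ℝ F w (EuclideanSpace.single j Complex.I)) / 2

/-- `∂F/∂z̄^j = (∂F/∂x^j + i ∂F/∂y^j) / 2`, where `z^j = x^j + i y^j`. -/
def wirtingerZbar {m : ℕ} (j : Fin m) (F : Cn m → ℂ) (w : Cn m) : ℂ :=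
  (fderiv ℝ F w (EuclideanSpace.single j 1)
    + Complex.I * fderiv ℝ F w (EuclideanSpace.single j Complex.I)) / 2

/-- The Levi form of `f`, evaluated at the point `w` on the vector `X`, that is
`∑_{j,k} (∂²f / ∂z^j ∂z̄^k)(w) X^j conj(X^k)`; this number is real when `f` is `C²`. -/
def leviForm {m : ℕ} (f : Cn m → ℝ) (w X : Cn m) : ℝ :=
  (∑ j : Fin m, ∑ k : Fin m,
    wirtingerZ j (wirtingerZbar k (fun v => (f v : ℂ))) w
      * X j * (starRingEnd ℂ) (X k)).re

/-! ### Subharmonic and plurisubharmonic functions with values in `[-∞, ∞)` -/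

/-- The mean value of `u` over the circle `|z - c| = r`: the Lebesgue integral of the positive part
minus that of the negative part, for the normalized arc length. The first integral is finite
when `u < ∞` is upper semicontinuous on the circle; the second one may be infinite. -/
def circleMean (u : ℂ → EReal) (c : ℂ) (r : ℝ) : EReal :=
  (((ENNReal.ofReal (2 * Real.pi))⁻¹ *
      ∫⁻ θ in Set.Ioc 0 (2 * Real.pi), (u (circleMap c r θ)).toENNReal : ℝ≥0∞) : EReal)
  - (((ENNReal.ofReal (2 * Real.pi))⁻¹ *
      ∫⁻ θ in Set.Ioc 0 (2 * Real.pi), (-u (circleMap c r θ)).toENNReal : ℝ≥0∞) : EReal)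

/-- `u : Ω → [-∞, ∞)` is subharmonic on the open set `Ω ⊆ ℂ`: it is upper semicontinuous and
satisfies the sub-mean value inequality. (The function `-∞` is allowed.) -/
structure IsSubharmonicOn (u : ℂ → EReal) (Ω : Set ℂ) : Prop where
  lt_top : ∀ z ∈ Ω, u z < ⊤
  upperSemicontinuousOn : UpperSemicontinuousOn u Ω
  le_circleMean : ∀ c : ℂ, ∀ r : ℝ, 0 < r → Metric.closedBall c r ⊆ Ω → u c ≤ circleMean u c r

section Manifold

variable (m : ℕ) {M : Type*} [TopologicalSpace M] [ChartedSpace (Cn m) M]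

/-- `f` restricts to a holomorphic map from the unit disc to the complex manifold `M`
(the values of `f` outside the disc are irrelevant). -/
def IsHolomorphicDisc (f : ℂ → M) : Prop :=
  MDifferentiableOn 𝓘(ℂ, ℂ) 𝓘(ℂ, Cn m) f unitDisc

/-- `u : M → [-∞, ∞)` is plurisubharmonic: it is upper semicontinuous and its composition with
every holomorphic disc is subharmonic (possibly identically `-∞`). -/
structure IsPlurisubharmonic (u : M → EReal) : Prop where
  lt_top : ∀ z, u z < ⊤
  upperSemicontinuous : UpperSemicontinuous u
  comp_disc : ∀ f : ℂ → M, IsHolomorphicDisc m f → IsSubharmonicOn (fun ζ => u (f ζ)) unitDisc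

variable (M) in
/-- `M` is taut: the holomorphic maps from the unit disc to `M` form a normal family, that is,
every sequence of them has a subsequence which either converges to a holomorphic map uniformly on
compact sets (convergence in the compact-open topology) or is compactly divergent. -/
def IsTaut : Prop :=
  ∀ f : ℕ → ℂ → M, (∀ n, IsHolomorphicDisc m (f n)) →
    ∃ σ : ℕ → ℕ, StrictMono σ ∧
      ((∃ g : ℂ → M, IsHolomorphicDisc m g ∧
          ∀ K ⊆ unitDisc, IsCompact K → ∀ U : Set M, IsOpen U → Set.MapsTo g K U →
            ∀ᶠ n in Filter.atTop, Set.MapsTo (f (σ n)) K U) ∨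
        (∀ K ⊆ unitDisc, IsCompact K → ∀ L : Set M, IsCompact L →
            ∀ᶠ n in Filter.atTop, Disjoint (f (σ n) '' K) L))

/-- The condition on `s` in the definition of the weak squeezing function at `z`: there are a
holomorphic embedding `Φ : 𝔹^m → M` with `Φ 0 = z` (given by a map on `ℂ^m` whose values outside
the ball are irrelevant) and a `C²` function `φ : M → [0, 1]` with `φ z = 0` such that
`log φ` (which is `-∞` where `φ = 0`) is plurisubharmonic and the Levi form of `φ ∘ Φ` is at least
`s²` times the Euclidean metric on `𝔹^m`. -/
def IsWeakSqueezingBound (z : M) (s : ℝ) : Prop :=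
  ∃ (Φ : Cn m → M) (φ : M → ℝ),
    Manifold.IsSmoothEmbedding 𝓘(ℂ, Cn m) 𝓘(ℂ, Cn m) ω (fun w : unitBall m => Φ w) ∧
    ContMDiff 𝓘(ℝ, Cn m) 𝓘(ℝ, ℝ) 2 φ ∧
    (∀ p, φ p ∈ Set.Icc (0 : ℝ) 1) ∧
    Φ 0 = z ∧ φ z = 0 ∧
    IsPlurisubharmonic m (fun p => ENNReal.log (ENNReal.ofReal (φ p))) ∧
    ∀ w ∈ unitBall m, ∀ X : Cn m, s ^ 2 * ‖X‖ ^ 2 ≤ leviForm (fun v => φ (Φ v)) w X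

/-- The weak squeezing function of the complex `m`-manifold `M`, with values in `[0, 1]`
(the supremum of the empty set is `0`). -/
def weakSqueezing (z : M) : ℝ :=
  sSup {s : ℝ | s ∈ Set.Icc (0 : ℝ) 1 ∧ IsWeakSqueezingBound m z s}

variable (M) in
/-- `M` is biholomorphic to the unit ball of `ℂ^m`: there is a holomorphic bijection with
holomorphic inverse. -/
def IsBiholomorphicToBall : Prop :=
  ∃ F : M ≃ unitBall m,
    MDifferentiable 𝓘(ℂ, Cn m) 𝓘(ℂ, Cn m) F ∧ MDifferentiable 𝓘(ℂ, Cn m) 𝓘(ℂ, Cn m) F.symm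

end Manifold

end

/-! Choose witnesses `(Φ n, φ n)` for admissible `s n → 1`. Two opposite estimates control them.
Since `φ n` is `C²`, nonnegative and zero at `z`, it vanishes there to second order; as `log φ n ≤
0` is plurisubharmonic, a Schwarz lemma bounds `φ n` by `|ζ|²` along every holomorphic disc through
`z`, so `φ n ∘ Φ n ≤ ‖w‖²` (`IsSqueezingPair.apply_le_norm_sq`). Conversely the Levi form bound
makes the mean of `φ n ∘ Φ n` over the circle through `w` at least `s n ^ 2 * ‖w‖²`
(`IsSqueezingPair.le_integral`). The functions `φ n` themselves never need a limit.

Tautness and `Φ n 0 = z` give a holomorphic limit `Ψ` of `Φ n` along an ultrafilter. If `dΨ` killed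
a vector at `0`, the Schwarz lemma in a chart would make `φ n ∘ Φ n` too small on a circle for the
lower mean bound. By Hurwitz the Jacobian of `Ψ` then vanishes nowhere, and a quantitative inverse
function theorem, uniform in `n`, shows that `Ψ` is open and injective.

It remains to see that the image is closed, since `M` is connected. Near a point `p` of its closure
there is an open set on which `φ n ≤ b < 1` for almost all `n`; subharmonicity of `log φ n` on discs
spreads this to `φ n ≤ τ < 1` on a neighbourhood of `p`. The two estimates together force `‖w‖² ≤ τ`
whenever `Ψ w` is close to `p`, so `p` is a limit of points in the image of a compact ball, and lies
in that image. -/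

open Filter Set Metric
open scoped Topology

/-! ### The Schwarz lemma for log-subharmonic functions on the disc -/

/-- If `log u` is subharmonic, `0 ≤ u ≤ 1`, and `u ≤ exp h` on a circle, then the value of `u` at the
centre is at most the exponential of the mean of `h`. -/
theorem IsSubharmonicOn.le_exp_mean {u : ℂ → ℝ} {Ω : Set ℂ}
    (hu : IsSubharmonicOn (fun ζ => ENNReal.log (ENNReal.ofReal (u ζ))) Ω)
    (h1 : ∀ ζ ∈ Ω, u ζ ≤ 1) {c : ℂ} {r : ℝ} (hr : 0 < r)
    (hΩ : closedBall c r ⊆ Ω) {h : ℝ → ℝ}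
    (hint : IntervalIntegrable h MeasureTheory.volume 0 (2 * Real.pi))
    (hle : ∀ θ, u (circleMap c r θ) ≤ Real.exp (h θ)) :
    u c ≤ Real.exp ((2 * Real.pi)⁻¹ * ∫ θ in (0 : ℝ)..(2 * Real.pi), h θ) := by
  have hpi : (0 : ℝ) < 2 * Real.pi := by positivity
  have hpi' : (2 * Real.pi : ℝ) ≠ 0 := hpi.ne'
  rcases le_or_gt (u c) 0 with h0 | h0
  · exact h0.trans (Real.exp_pos _).le
  have hlog : ∀ t : ℝ, 0 < t → ENNReal.log (ENNReal.ofReal t) = ((Real.log t : ℝ) : EReal) := by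
    intro t ht
    exact ENNReal.log_ofReal_of_pos ht
  have hmem : ∀ θ, circleMap c r θ ∈ Ω := fun θ => hΩ (circleMap_mem_closedBall c hr.le θ)
  have key := hu.le_circleMean c r hr hΩ
  have hzero : ∀ θ, (ENNReal.log (ENNReal.ofReal (u (circleMap c r θ)))).toENNReal = 0 := by
    intro θ
    rw [EReal.toENNReal_eq_zero_iff]
    have : ENNReal.ofReal (u (circleMap c r θ)) ≤ 1 := by
      simpa using ENNReal.ofReal_le_ofReal (h1 _ (hmem θ))
    simpa using ENNReal.log_monotone this
  unfold circleMean at key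
  simp only [hzero, MeasureTheory.lintegral_zero, mul_zero, EReal.coe_ennreal_zero, zero_sub] at key
  rw [hlog _ h0, EReal.le_neg] at key
  -- As `u ≤ 1`, only the negative part of `log u` contributes. Truncating `h` at `0` keeps it above
  -- `log u` on the circle and makes `-k` nonnegative, so lower integrals can be compared without
  -- measurability of `u`.
  set k : ℝ → ℝ := fun θ => min (h θ) 0 with hk
  have hkint : IntervalIntegrable k MeasureTheory.volume 0 (2 * Real.pi) := by
    have : IntervalIntegrable (fun θ => h θ ⊓ 0) MeasureTheory.volume 0 (2 * Real.pi) :=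
      ⟨hint.1.inf (MeasureTheory.integrable_zero _ _ _),
        hint.2.inf (MeasureTheory.integrable_zero _ _ _)⟩
    exact this
  have hψ : ∀ θ, ENNReal.ofReal (-k θ) ≤
      (-ENNReal.log (ENNReal.ofReal (u (circleMap c r θ)))).toENNReal := by
    intro θ
    rcases le_or_gt (u (circleMap c r θ)) 0 with hu0 | hu0
    · simp [ENNReal.ofReal_of_nonpos hu0]
    · rw [hlog _ hu0, ← EReal.coe_neg, EReal.toENNReal_of_ne_top (EReal.coe_ne_top _),
        EReal.toReal_coe]
      apply ENNReal.ofReal_le_ofReal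
      apply neg_le_neg
      refine le_min ?_ (Real.log_nonpos hu0.le (h1 _ (hmem θ)))
      exact (Real.log_le_iff_le_exp hu0).2 (hle θ)
  have hk0 : ∀ θ, 0 ≤ -k θ := fun θ => by simp [hk]
  have e1 : ∫⁻ θ in Ioc 0 (2 * Real.pi), ENNReal.ofReal (-k θ) =
      ENNReal.ofReal (∫ θ in (0 : ℝ)..(2 * Real.pi), -k θ) := by
    rw [intervalIntegral.integral_of_le hpi.le,
      MeasureTheory.ofReal_integral_eq_lintegral_ofReal]
    · exact hkint.neg.1
    · exact Filter.Eventually.of_forall hk0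
  have hI0 : 0 ≤ ∫ θ in (0 : ℝ)..(2 * Real.pi), -k θ :=
    intervalIntegral.integral_nonneg hpi.le fun θ _ => hk0 θ
  have e2 : (((2 * Real.pi)⁻¹ * ∫ θ in (0 : ℝ)..(2 * Real.pi), -k θ : ℝ) : EReal) ≤
      (((ENNReal.ofReal (2 * Real.pi))⁻¹ * ∫⁻ θ in Ioc 0 (2 * Real.pi),
        (-ENNReal.log (ENNReal.ofReal (u (circleMap c r θ)))).toENNReal : ℝ≥0∞) : EReal) := by
    have e3 : ENNReal.ofReal ((2 * Real.pi)⁻¹ * ∫ θ in (0 : ℝ)..(2 * Real.pi), -k θ) ≤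
        (ENNReal.ofReal (2 * Real.pi))⁻¹ * ∫⁻ θ in Ioc 0 (2 * Real.pi),
        (-ENNReal.log (ENNReal.ofReal (u (circleMap c r θ)))).toENNReal := by
      rw [ENNReal.ofReal_mul (by positivity), ENNReal.ofReal_inv_of_pos hpi, ← e1]
      gcongr with θ
      exact hψ θ
    refine le_trans ?_ (EReal.coe_ennreal_le_coe_ennreal_iff.2 e3)
    rw [EReal.coe_ennreal_ofReal, max_eq_left (by positivity)]
  have e4 := e2.trans key
  rw [← EReal.coe_neg, EReal.coe_le_coe_iff, intervalIntegral.integral_neg] at e4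
  have e5 : ∫ θ in (0 : ℝ)..(2 * Real.pi), k θ ≤ ∫ θ in (0 : ℝ)..(2 * Real.pi), h θ :=
    intervalIntegral.integral_mono_on hpi.le hkint hint fun θ _ => min_le_left _ _
  rw [← Real.log_le_iff_le_exp h0]
  have e6 := mul_le_mul_of_nonneg_left e5 (inv_nonneg.2 hpi.le)
  linarith

theorem norm_sq_circleMap_integral (c : ℂ) (r : ℝ) :
    ∫ θ in (0 : ℝ)..(2 * Real.pi), ‖circleMap c r θ‖ ^ 2 =
      2 * Real.pi * (‖c‖ ^ 2 + r ^ 2) := by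
  have : ∀ θ, ‖circleMap c r θ‖ ^ 2 =
      (‖c‖ ^ 2 + r ^ 2) + 2 * c.re * r * Real.cos θ + 2 * c.im * r * Real.sin θ := by
    intro θ
    rw [← Complex.normSq_eq_norm_sq, ← Complex.normSq_eq_norm_sq, Complex.normSq_apply,
      Complex.normSq_apply]
    have e1 : (circleMap c r θ).re = c.re + r * Real.cos θ := by
      simp [circleMap, Complex.exp_mul_I, Complex.cos_ofReal_re, Complex.sin_ofReal_im]
    have e2 : (circleMap c r θ).im = c.im + r * Real.sin θ := by
      simp [circleMap, Complex.exp_mul_I, Complex.cos_ofReal_im, Complex.sin_ofReal_re]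
    rw [e1, e2]
    linear_combination r ^ 2 * Real.cos_sq_add_sin_sq θ
  simp_rw [this]
  rw [intervalIntegral.integral_add, intervalIntegral.integral_add]
  · simp [integral_cos, integral_sin]
    ring
  all_goals exact Continuous.intervalIntegrable (by fun_prop) _ _

/-- The closed disc misses the origin, so `log ‖ζ‖` is harmonic on it and has the mean value
property. -/
theorem log_norm_circleMap_integral {c : ℂ} {r : ℝ} (hr : 0 < r) (hc : r < ‖c‖) :
    ∫ θ in (0 : ℝ)..(2 * Real.pi), Real.log ‖circleMap c r θ‖ =
      2 * Real.pi * Real.log ‖c‖ := by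
  have h := InnerProductSpace.HarmonicOnNhd.circleAverage_eq (f := fun ζ : ℂ => Real.log ‖ζ‖)
    (c := c) (R := r) (by
      intro x hx
      apply AnalyticAt.harmonicAt_log_norm (by fun_prop)
      rintro rfl
      rw [abs_of_pos hr, mem_closedBall, dist_eq_norm, zero_sub, norm_neg] at hx
      linarith)
  rw [Real.circleAverage_def, smul_eq_mul] at h
  have hpi : (0 : ℝ) < 2 * Real.pi := by positivity
  field_simp at h
  linarith

/-- The Schwarz lemma for functions `u` with `log u` subharmonic on the unit disc, vanishing to
second order at the origin. -/
theorem IsSubharmonicOn.le_norm_sq {u : ℂ → ℝ}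
    (hu : IsSubharmonicOn (fun ζ => ENNReal.log (ENNReal.ofReal (u ζ))) unitDisc)
    (h0 : ∀ ζ ∈ unitDisc, 0 ≤ u ζ) (h1 : ∀ ζ ∈ unitDisc, u ζ ≤ 1)
    (hc : ContinuousOn u unitDisc) {C : ℝ} (hC : ∀ᶠ ζ in 𝓝 (0 : ℂ), u ζ ≤ C * ‖ζ‖ ^ 2)
    {ζ : ℂ} (hζ : ζ ∈ unitDisc) : u ζ ≤ ‖ζ‖ ^ 2 := by
  have hu00 : u 0 = 0 := le_antisymm (by simpa using hC.self_of_nhds)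
    (h0 0 (by simp [unitDisc]))
  -- Both uses of `ε` serve the maximum principle. The exponent `2 * (1 - ε)` instead of `2` makes
  -- the quotient tend to `0` at the origin, so it is continuous; the factor `exp (ε * ‖ζ‖ ^ 2)`
  -- makes its logarithm strictly subharmonic elsewhere, so a positive maximum sits on `‖ζ‖ = R`.
  -- Then `ε → 0` and `R → 1`.
  have main : ∀ ε : ℝ, 0 < ε → ε < 1 → ∀ R : ℝ, 0 < R → R < 1 → ∀ ζ ∈ closedBall (0 : ℂ) R,
      u ζ * Real.exp (ε * ‖ζ‖ ^ 2) / ‖ζ‖ ^ (2 * (1 - ε)) ≤ Real.exp ε / R ^ (2 * (1 - ε)) := by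
    intro ε hε hε1 R hR hR1
    set w : ℂ → ℝ := fun ζ => u ζ * Real.exp (ε * ‖ζ‖ ^ 2) / ‖ζ‖ ^ (2 * (1 - ε)) with hw
    have hsub : closedBall (0 : ℂ) R ⊆ unitDisc := closedBall_subset_ball hR1
    have hw0 : w 0 = 0 := by simp [hw, hu00]
    have hcw : ContinuousOn w (closedBall 0 R) := by
      intro ζ hζ
      by_cases hz : ζ = 0
      · subst hz
        apply ContinuousAt.continuousWithinAt
        rw [ContinuousAt, hw0]
        have hbd : Tendsto (fun ζ : ℂ => C * Real.exp ε * ‖ζ‖ ^ (2 * ε)) (𝓝 0) (𝓝 0) := by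
          have : ContinuousAt (fun ζ : ℂ => C * Real.exp ε * ‖ζ‖ ^ (2 * ε)) 0 :=
            (continuousAt_const.mul (continuous_norm.continuousAt.rpow_const (Or.inr (by positivity))))
          have h := this.tendsto
          simpa [Real.zero_rpow (by positivity : 2 * ε ≠ 0)] using h
        refine squeeze_zero' ?_ ?_ hbd
        · filter_upwards [ball_mem_nhds (0 : ℂ) one_pos] with ζ hζ
          exact div_nonneg (mul_nonneg (h0 ζ hζ) (Real.exp_pos _).le) (by positivity)
        · filter_upwards [ball_mem_nhds (0 : ℂ) one_pos, hC] with ζ hζ hCζ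
          by_cases hz : ζ = 0
          · rw [hz, hw0]; simp [Real.zero_rpow (by positivity : 2 * ε ≠ 0)]
          have hn : 0 < ‖ζ‖ := norm_pos_iff.2 hz
          have hn1 : ‖ζ‖ < 1 := by simpa using hζ
          rw [hw]
          simp only
          rw [div_le_iff₀ (by positivity), mul_assoc, ← Real.rpow_add hn,
            show 2 * ε + 2 * (1 - ε) = ((2 : ℕ) : ℝ) by push_cast; ring, Real.rpow_natCast]
          calc u ζ * Real.exp (ε * ‖ζ‖ ^ 2) ≤ u ζ * Real.exp ε := by
                have := h0 ζ hζ
                have hsq : ‖ζ‖ ^ 2 ≤ 1 := pow_le_one₀ hn.le hn1.le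
                gcongr
                nlinarith
            _ ≤ C * ‖ζ‖ ^ 2 * Real.exp ε := by gcongr
            _ = _ := by ring
      · have hn : 0 < ‖ζ‖ := norm_pos_iff.2 hz
        refine ContinuousWithinAt.div (((hc.mono hsub) ζ hζ).mul (by fun_prop)) ?_ (by positivity)
        exact (continuous_norm.continuousAt.rpow_const (Or.inl hn.ne')).continuousWithinAt
    obtain ⟨ζ0, hζ0, hmax⟩ := (isCompact_closedBall (0 : ℂ) R).exists_isMaxOn
      ⟨0, by simp [hR.le]⟩ hcw
    suffices hs : w ζ0 ≤ Real.exp ε / R ^ (2 * (1 - ε)) from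
      fun ζ hζ => (hmax hζ).trans hs
    have hnR : ‖ζ0‖ ≤ R := by simpa using hζ0
    rcases le_or_gt (w ζ0) 0 with hw0' | hwpos
    · exact hw0'.trans (by positivity)
    rcases hnR.eq_or_lt with he | hlt
    · rw [hw]
      simp only
      rw [he]
      gcongr
      calc u ζ0 * Real.exp (ε * R ^ 2) ≤ 1 * Real.exp (ε * 1) := by
            gcongr
            · exact h1 _ (hsub hζ0)
            · nlinarith
        _ = _ := by simp
    exfalso
    have hz0 : ζ0 ≠ 0 := by rintro rfl; exact hwpos.ne' hw0
    have hn : 0 < ‖ζ0‖ := norm_pos_iff.2 hz0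
    obtain ⟨r, hr, hr2⟩ := exists_between (lt_min hn (sub_pos.2 hlt))
    have hrn := hr2.trans_le (min_le_left _ _)
    have hrR := hr2.trans_le (min_le_right _ _)
    have hball : closedBall ζ0 r ⊆ closedBall 0 R :=
      closedBall_subset_closedBall' (by simp; linarith)
    have hcm : ∀ θ, circleMap ζ0 r θ ≠ 0 := by
      intro θ h
      have := circleMap_mem_sphere ζ0 hr.le θ
      rw [h] at this
      simp at this
      linarith
    have hcont : Continuous fun θ => Real.log ‖circleMap ζ0 r θ‖ :=
      (continuous_circleMap ζ0 r).norm.log fun θ => norm_ne_zero_iff.2 (hcm θ)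
    have hcont2 : Continuous fun θ => ‖circleMap ζ0 r θ‖ ^ 2 :=
      (continuous_circleMap ζ0 r).norm.pow 2
    -- Maximality of `w ζ0` says exactly `u ≤ exp h` on the circle. The mean of `h` is `log (u ζ0) -
    -- ε * r ^ 2`, which contradicts the sub-mean value inequality.
    set h : ℝ → ℝ := fun θ => Real.log (w ζ0) + 2 * (1 - ε) * Real.log ‖circleMap ζ0 r θ‖ -
      ε * ‖circleMap ζ0 r θ‖ ^ 2 with hh
    have hexp : ∀ x : ℂ, x ≠ 0 → u x = Real.exp (Real.log (w x) + 2 * (1 - ε) * Real.log ‖x‖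
        - ε * ‖x‖ ^ 2) ∨ w x ≤ 0 := by
      intro x hx
      rcases le_or_gt (w x) 0 with hx0 | hx0
      · exact Or.inr hx0
      have hn : 0 < ‖x‖ := norm_pos_iff.2 hx
      left
      rw [Real.exp_sub, Real.exp_add, Real.exp_log hx0, mul_comm (2 * (1 - ε)),
        ← Real.rpow_def_of_pos hn, hw]
      field_simp
    have hle : ∀ θ, u (circleMap ζ0 r θ) ≤ Real.exp (h θ) := by
      intro θ
      have hm := hmax (hball (circleMap_mem_closedBall ζ0 hr.le θ))
      have hn : 0 < ‖circleMap ζ0 r θ‖ := norm_pos_iff.2 (hcm θ)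
      simp only [mem_ofPred_eq] at hm
      rw [hh]
      simp only
      rw [Real.exp_sub, Real.exp_add, Real.exp_log hwpos, mul_comm (2 * (1 - ε)),
        ← Real.rpow_def_of_pos hn, le_div_iff₀ (Real.exp_pos _)]
      rw [hw] at hm ⊢
      simp only at hm ⊢
      rwa [div_le_iff₀ (by positivity)] at hm
    have hfin := hu.le_exp_mean h1 hr (hball.trans hsub)
      ((by rw [hh]; fun_prop : Continuous h).intervalIntegrable _ _) hle
    have hval : (2 * Real.pi)⁻¹ * ∫ θ in (0 : ℝ)..(2 * Real.pi), h θ =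
        Real.log (w ζ0) + 2 * (1 - ε) * Real.log ‖ζ0‖ - ε * ‖ζ0‖ ^ 2 - ε * r ^ 2 := by
      have : ∫ θ in (0 : ℝ)..(2 * Real.pi), h θ = 2 * Real.pi *
          (Real.log (w ζ0) + 2 * (1 - ε) * Real.log ‖ζ0‖ - ε * ‖ζ0‖ ^ 2 - ε * r ^ 2) := by
        rw [hh, intervalIntegral.integral_sub, intervalIntegral.integral_add,
          intervalIntegral.integral_const_mul, intervalIntegral.integral_const_mul,
          norm_sq_circleMap_integral, log_norm_circleMap_integral hr hrn]
        · simp; ring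
        all_goals exact Continuous.intervalIntegrable (by fun_prop) _ _
      rw [this, inv_mul_cancel_left₀ (by positivity)]
    rw [hval, Real.exp_sub] at hfin
    rcases hexp ζ0 hz0 with he | he
    · rw [← he] at hfin
      have hup : 0 < u ζ0 := by rw [he]; exact Real.exp_pos _
      have : 1 < Real.exp (ε * r ^ 2) := Real.one_lt_exp_iff.2 (by positivity)
      rw [le_div_iff₀ (Real.exp_pos _)] at hfin
      nlinarith
    · linarith
  by_cases hz : ζ = 0
  · simp [hz, hu00]
  have hn : 0 < ‖ζ‖ := norm_pos_iff.2 hz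
  have hn1 : ‖ζ‖ < 1 := by simpa [unitDisc] using hζ
  have step : ∀ R : ℝ, ‖ζ‖ ≤ R → R < 1 → u ζ ≤ ‖ζ‖ ^ 2 / R ^ 2 := by
    intro R hζR hR1
    have hR : 0 < R := hn.trans_le hζR
    have t1 : Tendsto (fun ε : ℝ => u ζ * Real.exp (ε * ‖ζ‖ ^ 2) / ‖ζ‖ ^ (2 * (1 - ε)))
        (𝓝[>] 0) (𝓝 (u ζ * Real.exp (0 * ‖ζ‖ ^ 2) / ‖ζ‖ ^ (2 * (1 - (0:ℝ))))) := by
      have : ContinuousAt (fun ε : ℝ => u ζ * Real.exp (ε * ‖ζ‖ ^ 2) / ‖ζ‖ ^ (2 * (1 - ε))) 0 :=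
        ContinuousAt.div (by fun_prop)
          (ContinuousAt.rpow continuousAt_const (by fun_prop) (Or.inl hn.ne')) (by positivity)
      exact this.tendsto.mono_left nhdsWithin_le_nhds
    have t2 : Tendsto (fun ε : ℝ => Real.exp ε / R ^ (2 * (1 - ε)))
        (𝓝[>] 0) (𝓝 (Real.exp 0 / R ^ (2 * (1 - (0:ℝ))))) := by
      have : ContinuousAt (fun ε : ℝ => Real.exp ε / R ^ (2 * (1 - ε))) 0 :=
        ContinuousAt.div (by fun_prop)
          (ContinuousAt.rpow continuousAt_const (by fun_prop) (Or.inl hR.ne')) (by positivity)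
      exact this.tendsto.mono_left nhdsWithin_le_nhds
    have := le_of_tendsto_of_tendsto t1 t2 (by
      filter_upwards [Ioo_mem_nhdsGT (zero_lt_one (α := ℝ))] with ε hε
      exact main ε hε.1 hε.2 R hR hR1 ζ (by simpa using hζR))
    have e : (2 * (1 - (0 : ℝ))) = ((2 : ℕ) : ℝ) := by norm_num
    rw [e, Real.rpow_natCast, Real.rpow_natCast] at this
    simp only [zero_mul, Real.exp_zero, mul_one] at this
    rw [div_le_div_iff₀ (by positivity) (by positivity)] at this
    rw [le_div_iff₀ (by positivity)]
    linarith
  have t : Tendsto (fun R : ℝ => ‖ζ‖ ^ 2 / R ^ 2) (𝓝[<] 1) (𝓝 (‖ζ‖ ^ 2 / 1 ^ 2)) := by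
    have : ContinuousAt (fun R : ℝ => ‖ζ‖ ^ 2 / R ^ 2) 1 :=
      ContinuousAt.div (by fun_prop) (by fun_prop) (by norm_num)
    exact this.tendsto.mono_left nhdsWithin_le_nhds
  have := ge_of_tendsto t (by
    filter_upwards [Ioo_mem_nhdsLT hn1] with R hR
    exact step R hR.1.le hR.2)
  simpa using this

/-! ### The Levi form and the lower bound for circle means -/

/-- The right-hand side is the Laplacian at `0` of `ζ ↦ f (w + ζ X)`, that is `4 ∂²/∂ζ∂ζ̄`. With `X`
expanded in the real basis, the two sides agree term by term in `j`, `k`, so symmetry of the second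
derivative plays no role. -/
theorem leviForm_eq {m : ℕ} {f : Cn m → ℝ} {w : Cn m} (hf : ContDiffAt ℝ 2 f w) (X : Cn m) :
    4 * leviForm f w X = fderiv ℝ (fderiv ℝ f) w X X +
      fderiv ℝ (fderiv ℝ f) w (Complex.I • X) (Complex.I • X) := by
  set B := fderiv ℝ (fderiv ℝ f) w with hB
  have hd2 : DifferentiableAt ℝ (fderiv ℝ f) w :=
    (hf.fderiv_right (m := 1) (by norm_num)).differentiableAt (by norm_num)
  have hd1 : ∀ᶠ v in 𝓝 w, DifferentiableAt ℝ f v := by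
    filter_upwards [hf.eventually (by norm_num)] with v hv
    exact hv.differentiableAt (by norm_num)
  have hcoe : ∀ᶠ v in 𝓝 w, ∀ u, fderiv ℝ (fun v => (f v : ℂ)) v u = ((fderiv ℝ f v u : ℝ) : ℂ) := by
    filter_upwards [hd1] with v hv u
    have h1 : HasFDerivAt (fun v => (f v : ℂ)) (Complex.ofRealCLM ∘L fderiv ℝ f v) v :=
      Complex.ofRealCLM.hasFDerivAt.comp v hv.hasFDerivAt
    rw [h1.fderiv]
    rfl
  have hz : ∀ k : Fin m, ∀ u, fderiv ℝ (wirtingerZbar k (fun v => (f v : ℂ))) w u =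
      ((B u (EuclideanSpace.single k 1) : ℝ) +
        Complex.I * (B u (EuclideanSpace.single k Complex.I) : ℝ)) / 2 := by
    intro k u
    have heq : wirtingerZbar k (fun v => (f v : ℂ)) =ᶠ[𝓝 w] fun v =>
        (((fderiv ℝ f v (EuclideanSpace.single k 1) : ℝ) : ℂ) +
          Complex.I * ((fderiv ℝ f v (EuclideanSpace.single k Complex.I) : ℝ) : ℂ)) / 2 := by
      filter_upwards [hcoe] with v hv
      simp only [wirtingerZbar, hv]
    rw [heq.fderiv_eq]
    have hb : ∀ e : Cn m, HasFDerivAt (fun v => ((fderiv ℝ f v e : ℝ) : ℂ))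
        (Complex.ofRealCLM ∘L (B.flip e)) w := by
      intro e
      have h1 : HasFDerivAt (fun v => fderiv ℝ f v e) (B.flip e) w := by
        have := hd2.hasFDerivAt.clm_apply (hasFDerivAt_const e w)
        simpa using this
      exact Complex.ofRealCLM.hasFDerivAt.comp w h1
    have := (((hb (EuclideanSpace.single k 1)).add
      ((hb (EuclideanSpace.single k Complex.I)).const_mul Complex.I)).mul_const (2⁻¹ : ℂ))
    simp only [← div_eq_mul_inv, Pi.add_apply] at this
    rw [this.fderiv]
    simp
    ring
  have hX : X = ∑ j, ((X j).re • EuclideanSpace.single j (1 : ℂ) +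
      (X j).im • EuclideanSpace.single j Complex.I) := by
    ext i
    simp [Finset.sum_apply, Pi.single_apply, Finset.sum_add_distrib, Complex.re_add_im]
  have hIX : Complex.I • X = ∑ j, ((-(X j).im) • EuclideanSpace.single j (1 : ℂ) +
      (X j).re • EuclideanSpace.single j Complex.I) := by
    ext i
    simp [Finset.sum_apply, Pi.single_apply, Finset.sum_add_distrib]
    apply Complex.ext <;> simp
  have hL : leviForm f w X = ∑ j, ∑ k, (wirtingerZ j (wirtingerZbar k (fun v => (f v : ℂ))) w
      * X j * (starRingEnd ℂ) (X k)).re := by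
    simp [leviForm]
  rw [hL, hIX]
  conv_rhs => enter [1]; rw [hX]
  simp only [map_sum, sum_apply, Finset.mul_sum]
  rw [← Finset.sum_add_distrib]
  rw [Finset.sum_comm]
  refine Finset.sum_congr rfl fun j _ => ?_
  rw [← Finset.sum_add_distrib]
  refine Finset.sum_congr rfl fun k _ => ?_
  simp only [wirtingerZ, hz]
  simp only [map_add, map_smul, add_apply, smul_apply,
    smul_eq_mul]
  simp
  ring

theorem hasDerivAt_integral_circle {H H' : ℝ → ℝ → ℝ} {τ : ℝ}
    (hH : ContinuousOn (Function.uncurry H) (Iio τ ×ˢ univ))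
    (hH' : ContinuousOn (Function.uncurry H') (Iio τ ×ˢ univ))
    (hd : ∀ t < τ, ∀ θ, HasDerivAt (fun t => H t θ) (H' t θ) t) {t : ℝ} (ht : t < τ) :
    HasDerivAt (fun t => ∫ θ in (0 : ℝ)..(2 * Real.pi), H t θ)
      (∫ θ in (0 : ℝ)..(2 * Real.pi), H' t θ) t := by
  have hc : ∀ {K : ℝ → ℝ → ℝ}, ContinuousOn (Function.uncurry K) (Iio τ ×ˢ univ) →
      ∀ t < τ, Continuous (K t) := by
    intro K hK t ht
    rw [← continuousOn_univ]
    exact hK.comp (f := fun θ => (t, θ)) (by fun_prop) fun θ _ => ⟨ht, mem_univ _⟩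
  obtain ⟨b, hb, hbτ⟩ := exists_between ht
  set S : Set ℝ := Icc (t - 1) b
  have hcomp : IsCompact (S ×ˢ Icc 0 (2 * Real.pi)) := isCompact_Icc.prod isCompact_Icc
  obtain ⟨C, hC⟩ := hcomp.exists_bound_of_continuousOn (f := Function.uncurry H')
    (hH'.mono fun p hp => ⟨hp.1.2.trans_lt hbτ, mem_univ _⟩)
  refine (intervalIntegral.hasDerivAt_integral_of_dominated_loc_of_deriv_le
    (F := H) (F' := H') (s := S) (bound := fun _ => C)
    (Icc_mem_nhds (by linarith) hb) ?_ ((hc hH t ht).intervalIntegrable _ _)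
    (hc hH' t ht).aestronglyMeasurable ?_ (by simp) ?_).2
  · filter_upwards [Iio_mem_nhds ht] with x hx
    exact (hc hH x hx).aestronglyMeasurable
  · refine Eventually.of_forall fun θ hθ x hx => ?_
    rw [uIoc_of_le (by positivity)] at hθ
    exact hC (x, θ) ⟨hx, hθ.1.le, hθ.2⟩
  · exact Eventually.of_forall fun θ _ x hx => hd x (hx.2.trans_lt hbτ) θ

/-- Meant for `t` the logarithm of a radius, so that the limit at `-∞` is the value at the centre.
-/
theorem le_of_deriv_nonneg_of_tendsto_atBot {P P' : ℝ → ℝ} {τ a : ℝ}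
    (hd : ∀ t < τ, HasDerivAt P (P' t) t) (h0 : ∀ t < τ, 0 ≤ P' t)
    (hl : Tendsto P atBot (𝓝 a)) {t : ℝ} (ht : t < τ) : a ≤ P t := by
  have hm : MonotoneOn P (Iio τ) := by
    refine monotoneOn_of_deriv_nonneg (convex_Iio τ)
      (fun x hx => (hd x hx).continuousAt.continuousWithinAt)
      (fun x hx => (hd x (interior_subset (s := Iio τ) hx)).differentiableAt.differentiableWithinAt) ?_
    intro x hx
    rw [(hd x (interior_subset (s := Iio τ) hx)).deriv]
    exact h0 x (interior_subset (s := Iio τ) hx)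
  refine le_of_tendsto hl ?_
  filter_upwards [eventually_le_atBot t] with x hx
  exact hm (hx.trans_lt ht) ht hx

set_option maxHeartbeats 1600000 in
/-- The mean value inequality for functions whose Levi form dominates `s²` times the metric. -/
theorem le_integral_of_leviForm_ge {m : ℕ} {f : Cn m → ℝ} (hf : ContDiffOn ℝ 2 f (ball 0 1))
    {s : ℝ} (hL : ∀ w ∈ ball (0 : Cn m) 1, ∀ X : Cn m, s ^ 2 * ‖X‖ ^ 2 ≤ leviForm f w X)
    {w : Cn m} (hw : w ∈ ball (0 : Cn m) 1) :
    2 * Real.pi * (f 0 + s ^ 2 * ‖w‖ ^ 2) ≤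
      ∫ θ in (0 : ℝ)..(2 * Real.pi), f (Complex.exp (θ * Complex.I) • w) := by
  rcases eq_or_ne w 0 with rfl | hw0
  · simp
  have hn : 0 < ‖w‖ := norm_pos_iff.2 hw0
  have hn1 : ‖w‖ < 1 := by simpa using hw
  set τ : ℝ := -Real.log ‖w‖ with hτ
  have hτ0 : 0 < τ := by rw [hτ, neg_pos]; exact Real.log_neg hn hn1
  -- Logarithmic polar coordinates, valid for `t < τ`. Here `∂²/∂t² + ∂²/∂θ²` of `f ∘ γ` is `H2 +
  -- K2`, four times the Levi form on `γ`, and the `θ` part `K2` integrates to `0` by periodicity.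
  -- Hence the circle integral has second `t`-derivative at least `8π s² ‖w‖² exp (2t)`. Two
  -- integrations from `t = -∞` halve the constant twice, and `t = 0` gives the claim.
  set γ : ℝ → ℝ → Cn m := fun t θ => Complex.exp (t + θ * Complex.I) • w with hγ
  have hnγ : ∀ t θ, ‖γ t θ‖ = Real.exp t * ‖w‖ := by
    intro t θ
    simp [hγ, norm_smul, Complex.norm_exp]
  have hmem : ∀ t < τ, ∀ θ, γ t θ ∈ ball (0 : Cn m) 1 := by
    intro t ht θ
    rw [mem_ball_zero_iff, hnγ]
    calc Real.exp t * ‖w‖ < Real.exp τ * ‖w‖ := by gcongr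
      _ = 1 := by rw [hτ, Real.exp_neg, Real.exp_log hn, inv_mul_cancel₀ hn.ne']
  have hγc : Continuous (Function.uncurry γ) := by
    simp only [hγ, Function.uncurry_def]; fun_prop
  have hγt : ∀ t θ, HasDerivAt (fun t => γ t θ) (γ t θ) t := by
    intro t θ
    have h1 : HasDerivAt (fun t : ℝ => (t : ℂ) + θ * Complex.I) 1 t :=
      (Complex.ofRealCLM.hasDerivAt (x := t)).add_const _
    simpa using (h1.cexp).smul_const w
  have hγθ : ∀ t θ, HasDerivAt (fun θ => γ t θ) (Complex.I • γ t θ) θ := by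
    intro t θ
    have h1 : HasDerivAt (fun θ : ℝ => (t : ℂ) + θ * Complex.I) Complex.I θ := by
      simpa using ((Complex.ofRealCLM.hasDerivAt (x := θ)).mul_const Complex.I).const_add (t : ℂ)
    have := (h1.cexp).smul_const w
    rw [mul_comm, mul_smul] at this
    exact this
  have hper : ∀ t, γ t (2 * Real.pi) = γ t 0 := by
    intro t
    simp only [hγ]
    congr 1
    push_cast
    rw [Complex.exp_periodic t]
    simp
  have hγ0 : ∀ θ, γ 0 θ = Complex.exp (θ * Complex.I) • w := by simp [hγ]
  clear_value γ
  have hII : ∀ x : Cn m, Complex.I • Complex.I • x = -x := fun x => by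
    rw [smul_smul, Complex.I_mul_I, neg_one_smul]
  have hfa : ∀ v ∈ ball (0 : Cn m) 1, ContDiffAt ℝ 2 f v := fun v hv =>
    hf.contDiffAt (isOpen_ball.mem_nhds hv)
  have hD1 : ∀ v ∈ ball (0 : Cn m) 1, HasFDerivAt f (fderiv ℝ f v) v := fun v hv =>
    ((hfa v hv).differentiableAt (by norm_num)).hasFDerivAt
  have hD2 : ∀ v ∈ ball (0 : Cn m) 1, HasFDerivAt (fderiv ℝ f) (fderiv ℝ (fderiv ℝ f) v) v :=
    fun v hv => (((hfa v hv).fderiv_right (m := 1) (by norm_num)).differentiableAt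
      (by norm_num)).hasFDerivAt
  have hC1 : ContDiffOn ℝ 1 (fderiv ℝ f) (ball 0 1) :=
    hf.fderiv_of_isOpen isOpen_ball (by norm_num)
  have hC2 : ContinuousOn (fderiv ℝ (fderiv ℝ f)) (ball 0 1) :=
    hC1.continuousOn_fderiv_of_isOpen isOpen_ball (by norm_num)
  have hmaps : MapsTo (Function.uncurry γ) (Iio τ ×ˢ univ) (ball 0 1) :=
    fun p hp => hmem p.1 hp.1 p.2
  have hc0 := hf.continuousOn.comp hγc.continuousOn hmaps
  have hc1 := hC1.continuousOn.comp hγc.continuousOn hmaps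
  have hc2 := hC2.comp hγc.continuousOn hmaps
  set H : ℝ → ℝ → ℝ := fun t θ => f (γ t θ)
  set H1 : ℝ → ℝ → ℝ := fun t θ => fderiv ℝ f (γ t θ) (γ t θ)
  set H2 : ℝ → ℝ → ℝ := fun t θ =>
    fderiv ℝ (fderiv ℝ f) (γ t θ) (γ t θ) (γ t θ) + fderiv ℝ f (γ t θ) (γ t θ)
  set K1 : ℝ → ℝ → ℝ := fun t θ => fderiv ℝ f (γ t θ) (Complex.I • γ t θ)
  set K2 : ℝ → ℝ → ℝ := fun t θ =>
    fderiv ℝ (fderiv ℝ f) (γ t θ) (Complex.I • γ t θ) (Complex.I • γ t θ) -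
      fderiv ℝ f (γ t θ) (γ t θ)
  have cH : ContinuousOn (Function.uncurry H) (Iio τ ×ˢ univ) := hc0
  have cH1 : ContinuousOn (Function.uncurry H1) (Iio τ ×ˢ univ) :=
    hc1.clm_apply hγc.continuousOn
  have cH2 : ContinuousOn (Function.uncurry H2) (Iio τ ×ˢ univ) :=
    ((hc2.clm_apply hγc.continuousOn).clm_apply hγc.continuousOn).add cH1
  have cK2 : ContinuousOn (Function.uncurry K2) (Iio τ ×ˢ univ) :=
    ((hc2.clm_apply (hγc.const_smul Complex.I).continuousOn).clm_apply
      (hγc.const_smul Complex.I).continuousOn).sub cH1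
  have slice : ∀ {K : ℝ → ℝ → ℝ}, ContinuousOn (Function.uncurry K) (Iio τ ×ˢ univ) →
      ∀ t < τ, Continuous (K t) := by
    intro K hK t ht
    rw [← continuousOn_univ]
    exact hK.comp (f := fun θ => (t, θ)) (by fun_prop) fun θ _ => ⟨ht, mem_univ _⟩
  have dH : ∀ t < τ, ∀ θ, HasDerivAt (fun t => H t θ) (H1 t θ) t := fun t ht θ =>
    (hD1 _ (hmem t ht θ)).comp_hasDerivAt t (hγt t θ)
  have dH1 : ∀ t < τ, ∀ θ, HasDerivAt (fun t => H1 t θ) (H2 t θ) t := fun t ht θ =>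
    ((hD2 _ (hmem t ht θ)).comp_hasDerivAt t (hγt t θ)).clm_apply (hγt t θ)
  have dK1 : ∀ t < τ, ∀ θ, HasDerivAt (fun θ => K1 t θ) (K2 t θ) θ := by
    intro t ht θ
    have := ((hD2 _ (hmem t ht θ)).comp_hasDerivAt θ (hγθ t θ)).clm_apply
      ((hγθ t θ).const_smul Complex.I)
    refine this.congr_deriv ?_
    change _ + fderiv ℝ f (γ t θ) (Complex.I • Complex.I • γ t θ) = _
    rw [hII, map_neg, ← sub_eq_add_neg]
    rfl
  have hK : ∀ t < τ, ∫ θ in (0 : ℝ)..(2 * Real.pi), K2 t θ = 0 := by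
    intro t ht
    rw [intervalIntegral.integral_eq_sub_of_hasDerivAt (fun θ _ => dK1 t ht θ)
      ((slice cK2 t ht).intervalIntegrable _ _)]
    simp only [K1, hper, sub_self]
  have dG := fun t (ht : t < τ) => hasDerivAt_integral_circle cH cH1 dH ht
  have dN := fun t (ht : t < τ) => hasDerivAt_integral_circle cH1 cH2 dH1 ht
  have hN : ∀ t < τ, 8 * Real.pi * s ^ 2 * ‖w‖ ^ 2 * Real.exp (2 * t) ≤
      ∫ θ in (0 : ℝ)..(2 * Real.pi), H2 t θ := by
    intro t ht
    have e1 : ∫ θ in (0 : ℝ)..(2 * Real.pi), H2 t θ =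
        ∫ θ in (0 : ℝ)..(2 * Real.pi), (H2 t θ + K2 t θ) := by
      rw [intervalIntegral.integral_add ((slice cH2 t ht).intervalIntegrable _ _)
        ((slice cK2 t ht).intervalIntegrable _ _), hK t ht, add_zero]
    rw [e1]
    have e2 : 8 * Real.pi * s ^ 2 * ‖w‖ ^ 2 * Real.exp (2 * t) =
        ∫ θ in (0 : ℝ)..(2 * Real.pi), 4 * (s ^ 2 * ‖w‖ ^ 2 * Real.exp (2 * t)) := by
      simp; ring
    rw [e2]
    refine intervalIntegral.integral_mono_on (by positivity) (by simp)
      (((slice cH2 t ht).add (slice cK2 t ht)).intervalIntegrable _ _) fun θ _ => ?_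
    have h1 := hL _ (hmem t ht θ) (γ t θ)
    have h2 := leviForm_eq (hfa _ (hmem t ht θ)) (γ t θ)
    rw [hnγ, mul_pow, ← Real.exp_nat_mul] at h1
    push_cast at h1
    simp only [H2, K2]
    nlinarith
  obtain ⟨C, hC⟩ := (isCompact_closedBall (0 : Cn m) ‖w‖).exists_bound_of_continuousOn
    (hC1.continuousOn.mono (closedBall_subset_ball hn1))
  have hγcl : ∀ t ≤ 0, ∀ θ, γ t θ ∈ closedBall (0 : Cn m) ‖w‖ := by
    intro t ht θ
    rw [mem_closedBall_zero_iff, hnγ]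
    have : Real.exp t ≤ 1 := Real.exp_le_one_iff.2 ht
    nlinarith
  have texp : Tendsto (fun t : ℝ => C * (Real.exp t * ‖w‖) * |2 * Real.pi - 0|) atBot (𝓝 0) := by
    have := ((Real.tendsto_exp_atBot.mul_const ‖w‖).const_mul C).mul_const |2 * Real.pi - 0|
    simpa using this
  have texp2 : ∀ a : ℝ, Tendsto (fun t : ℝ => a * Real.exp (2 * t)) atBot (𝓝 0) := by
    intro a
    have : Tendsto (fun t : ℝ => Real.exp (2 * t)) atBot (𝓝 0) :=
      Real.tendsto_exp_atBot.comp (tendsto_id.const_mul_atBot (by norm_num))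
    simpa using this.const_mul a
  have dexp : ∀ a t : ℝ, HasDerivAt (fun t : ℝ => a * Real.exp (2 * t))
      (2 * a * Real.exp (2 * t)) t := by
    intro a t
    have := (((hasDerivAt_id t).const_mul 2).exp).const_mul a
    refine this.congr_deriv ?_
    simp; ring
  have lN : Tendsto (fun t => ∫ θ in (0 : ℝ)..(2 * Real.pi), H1 t θ) atBot (𝓝 0) := by
    refine squeeze_zero_norm' ?_ texp
    filter_upwards [eventually_le_atBot 0] with t ht
    refine intervalIntegral.norm_integral_le_of_norm_le_const fun θ _ => ?_
    refine ((fderiv ℝ f (γ t θ)).le_opNorm _).trans ?_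
    rw [hnγ]
    gcongr
    exact hC _ (hγcl t ht θ)
  have lG : Tendsto (fun t => ∫ θ in (0 : ℝ)..(2 * Real.pi), H t θ) atBot
      (𝓝 (2 * Real.pi * f 0)) := by
    rw [tendsto_iff_norm_sub_tendsto_zero]
    refine squeeze_zero' (Eventually.of_forall fun _ => norm_nonneg _) ?_ texp
    filter_upwards [eventually_le_atBot 0] with t ht
    have : ∫ θ in (0 : ℝ)..(2 * Real.pi), H t θ - f 0 =
        (∫ θ in (0 : ℝ)..(2 * Real.pi), H t θ) - 2 * Real.pi * f 0 := by
      rw [intervalIntegral.integral_sub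
        ((slice cH t (ht.trans_lt hτ0)).intervalIntegrable _ _) (by simp)]
      simp
    rw [← this]
    refine intervalIntegral.norm_integral_le_of_norm_le_const fun θ _ => ?_
    have := (convex_closedBall (0 : Cn m) ‖w‖).norm_image_sub_le_of_norm_hasFDerivWithin_le
      (f := f) (f' := fderiv ℝ f) (C := C)
      (fun x hx => (hD1 x (closedBall_subset_ball hn1 hx)).hasFDerivWithinAt) hC
      (mem_closedBall_self hn.le) (hγcl t ht θ)
    rwa [sub_zero, hnγ] at this
  have hP : ∀ t < τ, 0 ≤ (∫ θ in (0 : ℝ)..(2 * Real.pi), H1 t θ) -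
      (4 * Real.pi * s ^ 2 * ‖w‖ ^ 2) * Real.exp (2 * t) := by
    intro t ht
    refine le_of_deriv_nonneg_of_tendsto_atBot (τ := τ)
      (P := fun t => (∫ θ in (0 : ℝ)..(2 * Real.pi), H1 t θ) -
      (4 * Real.pi * s ^ 2 * ‖w‖ ^ 2) * Real.exp (2 * t))
      (fun t ht => (dN t ht).sub (dexp _ t)) (fun t ht => ?_) ?_ ht
    · have := hN t ht
      linarith
    · simpa using lN.sub (texp2 (4 * Real.pi * s ^ 2 * ‖w‖ ^ 2))
  have hQ := le_of_deriv_nonneg_of_tendsto_atBot (τ := τ) (a := 2 * Real.pi * f 0)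
      (P := fun t => (∫ θ in (0 : ℝ)..(2 * Real.pi), H t θ) -
      (2 * Real.pi * s ^ 2 * ‖w‖ ^ 2) * Real.exp (2 * t))
      (fun t ht => (dG t ht).sub (dexp _ t)) (fun t ht => by have := hP t ht; linarith)
      (by simpa using lG.sub (texp2 (2 * Real.pi * s ^ 2 * ‖w‖ ^ 2))) hτ0
  simp only [H, hγ0] at hQ
  simp only [mul_zero, Real.exp_zero, mul_one] at hQ
  linarith

/-! ### Continuous convergence -/

/-- Continuous convergence at `a` of the family `F` to `f` along the filter `l`. -/
def TendstoContinuouslyAt {ι α β : Type*} [TopologicalSpace α] [TopologicalSpace β]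
    (l : Filter ι) (F : ι → α → β) (f : α → β) (a : α) : Prop :=
  Tendsto (fun q : ι × α => F q.1 q.2) (l ×ˢ 𝓝 a) (𝓝 (f a))

namespace TendstoContinuouslyAt

variable {ι α β : Type*} [TopologicalSpace α] [TopologicalSpace β] {l : Filter ι}
  {F : ι → α → β} {f : α → β} {a : α}

theorem tendsto (h : TendstoContinuouslyAt l F f a) : Tendsto (fun n => F n a) l (𝓝 (f a)) :=
  h.comp (tendsto_id.prodMk tendsto_const_nhds)

theorem eventually_mem (h : TendstoContinuouslyAt l F f a) {V : Set β} (hV : V ∈ 𝓝 (f a)) :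
    ∃ T ∈ 𝓝 a, ∀ᶠ n in l, ∀ w ∈ T, F n w ∈ V := by
  obtain ⟨S, hS, T, hT, hST⟩ := mem_prod_iff.1 (h hV)
  exact ⟨T, hT, mem_of_superset hS fun n hn w hw => hST (mk_mem_prod hn hw)⟩

theorem continuousAt [RegularSpace β] [l.NeBot] (h : TendstoContinuouslyAt l F f a)
    (hp : ∀ᶠ w in 𝓝 a, Tendsto (fun n => F n w) l (𝓝 (f w))) : ContinuousAt f a := by
  rw [ContinuousAt, (closed_nhds_basis (f a)).tendsto_right_iff]
  rintro V ⟨hV, hVc⟩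
  obtain ⟨T, hT, hn⟩ := h.eventually_mem hV
  filter_upwards [hT, hp] with w hw hpw
  exact hVc.mem_of_tendsto hpw (hn.mono fun n hn => hn w hw)

theorem comp_continuousAt {γ : Type*} [TopologicalSpace γ] {k : β → γ}
    (h : TendstoContinuouslyAt l F f a) (hk : ContinuousAt k (f a)) :
    TendstoContinuouslyAt l (fun n w => k (F n w)) (fun w => k (f w)) a :=
  hk.tendsto.comp h

theorem comp_left {γ : Type*} [TopologicalSpace γ] {k : γ → α} {b : γ}
    (h : TendstoContinuouslyAt l F f (k b)) (hk : ContinuousAt k b) :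
    TendstoContinuouslyAt l (fun n w => F n (k w)) (fun w => f (k w)) b :=
  h.comp (tendsto_id.prodMap hk.tendsto)

end TendstoContinuouslyAt

/-- The limit is automatically continuous, so `(f y, F n y)` tends to a point of the diagonal. -/
theorem tendstoLocallyUniformlyOn_of_tendstoContinuouslyAt {ι α β : Type*} [TopologicalSpace α]
    [UniformSpace β] {l : Filter ι} [l.NeBot] {F : ι → α → β} {f : α → β} {U : Set α}
    (hU : IsOpen U) (h : ∀ a ∈ U, TendstoContinuouslyAt l F f a) :
    TendstoLocallyUniformlyOn F f l U := by
  rw [hU.tendstoLocallyUniformlyOn_iff_forall_tendsto]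
  intro a ha
  have hc : ContinuousAt f a := (h a ha).continuousAt (by
    filter_upwards [hU.mem_nhds ha] with w hw
    exact (h w hw).tendsto)
  have h1 : Tendsto (fun y : ι × α => (f y.2, F y.1 y.2)) (l ×ˢ 𝓝 a) (𝓝 (f a, f a)) := by
    rw [nhds_prod_eq]
    exact (hc.tendsto.comp tendsto_snd).prodMk (h a ha)
  exact h1.mono_right (nhds_le_uniformity _)

/-! ### Cauchy, Weierstrass and Hurwitz in several variables -/

section SeveralVariables

variable {E G : Type*} [NormedAddCommGroup E] [NormedSpace ℂ E]
  [NormedAddCommGroup G] [NormedSpace ℂ G]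

/-- Cauchy's estimate on the complex line through `w` in each direction `v`, in a disc of radius `δ
/ ‖v‖`. -/
theorem norm_fderiv_le_of_forall_mem_closedBall {g : E → G} {a w : E} {δ C : ℝ} (hδ : 0 < δ)
    (hg : ∀ x ∈ closedBall a (2 * δ), DifferentiableAt ℂ g x)
    (hC : ∀ x ∈ closedBall a (2 * δ), ‖g x‖ ≤ C) (hw : w ∈ closedBall a δ) :
    ‖fderiv ℂ g w‖ ≤ C / δ := by
  have hC0 : 0 ≤ C := (norm_nonneg _).trans (hC a (mem_closedBall_self (by positivity)))
  refine ContinuousLinearMap.opNorm_le_bound _ (by positivity) fun v => ?_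
  rcases eq_or_ne v 0 with rfl | hv
  · simp
  have hn : 0 < ‖v‖ := norm_pos_iff.2 hv
  have hmem : ∀ ζ : ℂ, ‖ζ‖ ≤ δ / ‖v‖ → w + ζ • v ∈ closedBall a (2 * δ) := by
    intro ζ hζ
    rw [mem_closedBall, dist_eq_norm] at hw ⊢
    rw [le_div_iff₀ hn] at hζ
    calc ‖w + ζ • v - a‖ = ‖(w - a) + ζ • v‖ := by congr 1; abel
      _ ≤ ‖w - a‖ + ‖ζ • v‖ := norm_add_le _ _
      _ ≤ 2 * δ := by rw [norm_smul]; linarith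
  have hline : ∀ ζ : ℂ, HasDerivAt (fun ζ : ℂ => w + ζ • v) v ζ := fun ζ => by
    simpa using ((hasDerivAt_id ζ).smul_const v).const_add w
  have hd : ∀ ζ : ℂ, ‖ζ‖ ≤ δ / ‖v‖ →
      HasDerivAt (fun ζ : ℂ => g (w + ζ • v)) (fderiv ℂ g (w + ζ • v) v) ζ := fun ζ hζ =>
    (hg _ (hmem ζ hζ)).hasFDerivAt.comp_hasDerivAt ζ (hline ζ)
  have hder := hd 0 (by simp; positivity)
  have key := Complex.norm_deriv_le_of_forall_mem_sphere_norm_le (c := 0) (R := δ / ‖v‖) (C := C)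
    (f := fun ζ : ℂ => g (w + ζ • v)) (by positivity) (by
      apply DifferentiableOn.diffContOnCl
      intro ζ hζ
      refine (hd ζ ?_).differentiableAt.differentiableWithinAt
      simpa using closure_ball_subset_closedBall hζ) (by
      intro ζ hζ
      exact hC _ (hmem ζ (by simpa using (mem_sphere_zero_iff_norm.1 hζ).le)))
  rw [hder.deriv, zero_smul, add_zero] at key
  refine key.trans (le_of_eq ?_)
  field_simp

/-- Weierstrass' theorem in several variables: derivatives of a locally uniformly convergent family
of holomorphic maps converge to the derivative of the limit. -/
theorem hasFDerivAt_limit [ProperSpace E] [CompleteSpace G] {ι : Type*} {l : Filter ι} [l.NeBot]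
    {F : ι → E → G} {f : E → G} {U : Set E} (hU : IsOpen U)
    (hF1 : ∀ᶠ n in l, ContDiffOn ℂ 1 (F n) U)
    (h : ∀ a ∈ U, TendstoContinuouslyAt l F f a) {a : E} (ha : a ∈ U) :
    DifferentiableAt ℂ f a ∧
      TendstoContinuouslyAt l (fun n => fderiv ℂ (F n)) (fderiv ℂ f) a := by
  have hF : ∀ᶠ n in l, DifferentiableOn ℂ (F n) U :=
    hF1.mono fun n hn => hn.differentiableOn (by norm_num)
  have hlu := tendstoLocallyUniformlyOn_of_tendstoContinuouslyAt hU h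
  obtain ⟨ρ, hρ, hball⟩ := nhds_basis_closedBall.mem_iff.1 (hU.mem_nhds ha)
  set δ := ρ / 2 with hδ
  have hδ0 : 0 < δ := by positivity
  have h2δ : closedBall a (2 * δ) ⊆ U := by
    rw [hδ, mul_div_cancel₀ _ (two_ne_zero)]; exact hball
  have hu : TendstoUniformlyOn F f l (closedBall a (2 * δ)) :=
    (tendstoLocallyUniformlyOn_iff_forall_isCompact hU).1 hlu _ h2δ (isCompact_closedBall _ _)
  rw [Metric.tendstoUniformlyOn_iff] at hu
  -- Cauchy's estimate applied to the differences `F n - F k` makes the derivatives uniformly Cauchy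
  -- on the half-size ball.
  have hcauchy : ∀ η > 0, ∀ᶠ p in l ×ˢ l, ∀ w ∈ closedBall a δ,
      ‖fderiv ℂ (F p.1) w - fderiv ℂ (F p.2) w‖ ≤ η := by
    intro η hη
    have h1 := (hu (η * δ / 2) (by positivity)).and hF
    filter_upwards [h1.prod_mk h1] with p hp w hw
    obtain ⟨⟨h1, h2⟩, h3, h4⟩ := hp
    have hd1 : ∀ x ∈ closedBall a (2 * δ), DifferentiableAt ℂ (F p.1) x := fun x hx =>
      h2.differentiableAt (hU.mem_nhds (h2δ hx))
    have hd2 : ∀ x ∈ closedBall a (2 * δ), DifferentiableAt ℂ (F p.2) x := fun x hx =>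
      h4.differentiableAt (hU.mem_nhds (h2δ hx))
    have hw2 : w ∈ closedBall a (2 * δ) := closedBall_subset_closedBall (by linarith) hw
    have := norm_fderiv_le_of_forall_mem_closedBall (g := F p.1 - F p.2) (C := η * δ) hδ0
      (fun x hx => (hd1 x hx).sub (hd2 x hx)) (fun x hx => by
        have e1 := h1 x hx
        have e2 := h3 x hx
        rw [Pi.sub_apply, ← dist_eq_norm]
        have := dist_triangle_left (F p.1 x) (F p.2 x) (f x)
        linarith) hw
    rw [fderiv_sub (hd1 w hw2) (hd2 w hw2), mul_div_assoc, div_self hδ0.ne', mul_one] at this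
    exact this
  have hlim : ∀ w, ∃ g', w ∈ closedBall a δ → Tendsto (fun n => fderiv ℂ (F n) w) l (𝓝 g') := by
    intro w
    by_cases hw : w ∈ closedBall a δ
    · have : Cauchy (map (fun n => fderiv ℂ (F n) w) l) := by
        rw [cauchy_map_iff]
        refine ⟨inferInstance, ?_⟩
        rw [Metric.uniformity_basis_dist_le.tendsto_right_iff]
        intro η hη
        filter_upwards [hcauchy η hη] with p hp
        rw [dist_eq_norm]
        exact hp w hw
      obtain ⟨g', hg'⟩ := cauchy_iff_exists_le_nhds.1 this
      exact ⟨g', fun _ => hg'⟩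
    · exact ⟨0, fun h => absurd h hw⟩
  choose g' hg' using hlim
  have hunif : TendstoUniformlyOn (fun n => fderiv ℂ (F n)) g' l (closedBall a δ) := by
    rw [Metric.tendstoUniformlyOn_iff]
    intro η hη
    have h1 := (hcauchy (η / 2) (by positivity)).curry
    filter_upwards [h1] with n hn w hw
    have t : Tendsto (fun k => ‖fderiv ℂ (F n) w - fderiv ℂ (F k) w‖) l
        (𝓝 ‖fderiv ℂ (F n) w - g' w‖) := ((hg' w hw).const_sub _).norm
    have := le_of_tendsto t (hn.mono fun k hk => hk w hw)
    rw [dist_comm, dist_eq_norm]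
    linarith
  have hderiv : ∀ w ∈ ball a δ, HasFDerivAt f (g' w) w := by
    intro w hw
    have hnw : closedBall a δ ∈ 𝓝 w := mem_of_superset (isOpen_ball.mem_nhds hw)
      ball_subset_closedBall
    have hUw : U ∈ 𝓝 w := mem_of_superset hnw
      ((closedBall_subset_closedBall (by linarith)).trans h2δ)
    refine hasFDerivAt_of_tendstoUniformlyOnFilter (l := l) (f := F)
      (f' := fun n => fderiv ℂ (F n)) (g := f) (g' := g') ?_ ?_ ?_
    · exact (tendstoUniformlyOn_iff_tendstoUniformlyOnFilter.1 hunif).mono_right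
        (le_principal_iff.2 hnw)
    · filter_upwards [hF.prod_mk (isOpen_interior.mem_nhds (mem_interior_iff_mem_nhds.2 hUw))]
        with q hq
      exact (hq.1.differentiableAt (mem_interior_iff_mem_nhds.1 hq.2)).hasFDerivAt
    · filter_upwards [hUw] with y hy
      exact (h y hy).tendsto
  have hda := hderiv a (mem_ball_self hδ0)
  refine ⟨hda.differentiableAt, ?_⟩
  rw [TendstoContinuouslyAt, hda.fderiv]
  have hnear : ball a δ ∈ 𝓝 a := ball_mem_nhds a hδ0
  have hu' := hunif.mono (ball_subset_closedBall (x := a) (ε := δ))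
  have hcont : ContinuousAt g' a := by
    refine (hu'.continuousOn (Eventually.frequently ?_)).continuousAt hnear
    filter_upwards [hF1] with n hn
    exact (hn.continuousOn_fderiv_of_isOpen hU (by norm_num)).mono fun x hx =>
      h2δ (closedBall_subset_closedBall (by linarith) (ball_subset_closedBall hx))
  rw [Metric.tendsto_nhds]
  rw [Metric.tendstoUniformlyOn_iff] at hu'
  intro η hη
  filter_upwards [(hu' (η / 2) (by positivity)).prod_mk
    (inter_mem hnear (Metric.continuousAt_iff'.1 hcont (η / 2) (by positivity)))] with q hq
  have e1 := hq.1 q.2 hq.2.1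
  have e2 := hq.2.2
  rw [dist_comm] at e1
  have e3 : dist (g' q.2) (g' a) < η / 2 := e2
  linarith [dist_triangle (fderiv ℂ (F q.1) q.2) (g' q.2) (g' a)]

/-- Hurwitz' theorem on zeros. -/
theorem eqOn_zero_of_tendsto_of_ne_zero {ι : Type*} {l : Filter ι} [l.NeBot] {g : ι → ℂ → ℂ}
    {g₀ : ℂ → ℂ} {Ω : Set ℂ} (hΩ : IsOpen Ω) (hconn : IsPreconnected Ω)
    (hd : ∀ᶠ n in l, DifferentiableOn ℂ (g n) Ω) (hne : ∀ᶠ n in l, ∀ z ∈ Ω, g n z ≠ 0)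
    (h : ∀ a ∈ Ω, TendstoContinuouslyAt l g g₀ a) {c : ℂ} (hc : c ∈ Ω) (hc0 : g₀ c = 0) :
    EqOn g₀ 0 Ω := by
  have hlu := tendstoLocallyUniformlyOn_of_tendstoContinuouslyAt hΩ h
  have hg0 : DifferentiableOn ℂ g₀ Ω := hlu.differentiableOn hd hΩ
  have han := hg0.analyticOnNhd hΩ
  rcases (han c hc).eventually_eq_zero_or_eventually_ne_zero with h0 | h0
  · exact han.eqOn_zero_of_preconnected_of_eventuallyEq_zero hconn hc h0
  exfalso
  rw [eventually_nhdsWithin_iff] at h0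
  obtain ⟨r, hr, hball⟩ := nhds_basis_closedBall.mem_iff.1 (inter_mem (hΩ.mem_nhds hc) h0)
  have hsΩ : sphere c r ⊆ Ω := fun z hz => (hball (sphere_subset_closedBall hz)).1
  obtain ⟨z1, hz1, hmin⟩ := (isCompact_sphere c r).exists_isMinOn
    ⟨c + r, by simp [hr.le]⟩ ((hg0.continuousOn.mono hsΩ).norm)
  set δ := ‖g₀ z1‖ with hδ
  have hδ0 : 0 < δ := norm_pos_iff.2 ((hball (sphere_subset_closedBall hz1)).2 (by
    rintro rfl
    simp at hz1
    exact hr.ne hz1))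
  have hu : TendstoUniformlyOn g g₀ l (sphere c r) :=
    (tendstoLocallyUniformlyOn_iff_forall_isCompact hΩ).1 hlu _ hsΩ (isCompact_sphere _ _)
  rw [Metric.tendstoUniformlyOn_iff] at hu
  -- Maximum principle for `1 / g n`: the bound `δ / 2` on the circle persists at the centre,
  -- although `g n c` tends to `0`.
  have hlow : ∀ᶠ n in l, δ / 2 ≤ ‖g n c‖ := by
    filter_upwards [hu (δ / 2) (by positivity), hd, hne] with n hn hdn hnn
    have key := Complex.norm_le_of_forall_mem_frontier_norm_le (U := ball c r)
      (f := fun z => (g n z)⁻¹) (C := (δ / 2)⁻¹) isBounded_ball (by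
        apply DifferentiableOn.diffContOnCl
        rw [closure_ball c hr.ne']
        exact (hdn.mono fun z hz => (hball hz).1).inv fun z hz => hnn z (hball hz).1) (by
        intro z hz
        rw [frontier_ball c hr.ne'] at hz
        rw [norm_inv]
        have h1 := hn z hz
        have h2 : δ ≤ ‖g₀ z‖ := hmin hz
        rw [dist_eq_norm] at h1
        have h3 := norm_sub_norm_le (g₀ z) (g n z)
        gcongr
        linarith) (subset_closure (mem_ball_self hr))
    rw [norm_inv] at key
    exact (inv_le_inv₀ (norm_pos_iff.2 (hnn c hc)) (by positivity)).1 key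
  have hl := ge_of_tendsto (h c hc).tendsto.norm hlow
  rw [hc0, norm_zero] at hl
  linarith

/-- Hurwitz' theorem on the complex line through `b` and `c`; convexity makes its intersection with
`U` preconnected. -/
theorem ne_zero_of_tendsto_of_ne_zero {ι : Type*} {l : Filter ι} [l.NeBot] {J : ι → E → ℂ}
    {J₀ : E → ℂ} {U : Set E} (hU : IsOpen U) (hconv : Convex ℝ U)
    (hd : ∀ᶠ n in l, DifferentiableOn ℂ (J n) U) (hne : ∀ᶠ n in l, ∀ z ∈ U, J n z ≠ 0)
    (h : ∀ a ∈ U, TendstoContinuouslyAt l J J₀ a) {b c : E} (hb : b ∈ U) (hb0 : J₀ b ≠ 0)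
    (hc : c ∈ U) : J₀ c ≠ 0 := by
  intro hc0
  set k : ℂ → E := fun ζ => c + ζ • (b - c) with hk
  have hkd : Differentiable ℂ k := by rw [hk]; fun_prop
  have h0 : k 0 = c := by simp [hk]
  have h1 : k 1 = b := by simp [hk]
  have hconv' : Convex ℝ (k ⁻¹' U) := by
    intro x hx y hy s t hs ht hst
    have := hconv hx hy hs ht hst
    rw [mem_preimage]
    convert this using 1
    simp only [hk]
    obtain rfl : t = 1 - s := by linarith
    rw [← Complex.coe_smul s (c + _), ← Complex.coe_smul (1 - s) (c + _), Complex.real_smul,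
      Complex.real_smul]
    push_cast
    module
  have := eqOn_zero_of_tendsto_of_ne_zero (g := fun n ζ => J n (k ζ)) (g₀ := fun ζ => J₀ (k ζ))
    (hU.preimage hkd.continuous) hconv'.isPreconnected
    (hd.mono fun n hn => hn.comp hkd.differentiableOn (mapsTo_preimage _ _))
    (hne.mono fun n hn ζ hζ => hn _ hζ)
    (fun ζ hζ => (h _ hζ).comp_left hkd.continuous.continuousAt)
    (c := 0) (by rw [mem_preimage, h0]; exact hc) (by rw [h0, hc0])
    (show (1 : ℂ) ∈ k ⁻¹' U by rw [mem_preimage, h1]; exact hb)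
  simp only [h1, Pi.zero_apply] at this
  exact hb0 this

/-- If `f` has invertible derivative at `a`, then the images under `F n` of a small closed ball
around `a` eventually contain a fixed neighbourhood of `f a`. -/
theorem exists_nhds_subset_image_closedBall [ProperSpace E] [CompleteSpace E] {ι : Type*}
    {l : Filter ι} [l.NeBot] {F : ι → E → E} {f : E → E} {U : Set E} (hU : IsOpen U)
    (hF : ∀ᶠ n in l, ContDiffOn ℂ 1 (F n) U) (h : ∀ a ∈ U, TendstoContinuouslyAt l F f a)
    {a : E} (ha : a ∈ U) (A : E ≃L[ℂ] E) (hA : fderiv ℂ f a = A) {ε : ℝ} (hε : 0 < ε) :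
    ∃ V ∈ 𝓝 (f a), ∀ᶠ n in l, V ⊆ F n '' closedBall a ε := by
  -- In dimension zero the norm of `A.symm` is `0` and yields no positive constant.
  rcases subsingleton_or_nontrivial E with hE | hE
  · exact ⟨univ, univ_mem, Eventually.of_forall fun n y _ =>
      ⟨a, mem_closedBall_self hε.le, Subsingleton.elim _ _⟩⟩
  have hN : 0 < ‖(A.symm : E →L[ℂ] E)‖₊ := A.nnnorm_symm_pos
  -- With half of `‖A⁻¹‖⁻¹` as linear approximation error, `F n` maps the `r`-ball onto a set
  -- containing the `c * r`-ball about `F n a`. Once `F n a` is within `c * r / 2` of `f a`, this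
  -- contains a fixed ball about `f a`.
  set c : NNReal := ‖(A.symm : E →L[ℂ] E)‖₊⁻¹ / 2 with hc
  have hc0 : 0 < c := by positivity
  obtain ⟨-, hconv⟩ := hasFDerivAt_limit hU hF h ha
  obtain ⟨T, hT, hTn⟩ := hconv.eventually_mem (closedBall_mem_nhds _ (NNReal.coe_pos.2 hc0))
  obtain ⟨r₀, hr₀, hball⟩ := nhds_basis_closedBall.mem_iff.1 (inter_mem hT (hU.mem_nhds ha))
  set r := min r₀ ε with hr
  have hrpos : 0 < r := lt_min hr₀ hε
  have hrr : closedBall a r ⊆ closedBall a r₀ := closedBall_subset_closedBall (min_le_left _ _)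
  refine ⟨ball (f a) (c * r / 2), ball_mem_nhds _ (by positivity), ?_⟩
  have hnear := (Metric.tendsto_nhds.1 (h a ha).tendsto) (c * r / 2) (by positivity)
  filter_upwards [hTn, hF, hnear] with n h1 h2 h3 y hy
  have happ : ApproximatesLinearOn (F n) (A : E →L[ℂ] E) (closedBall a r) c := by
    intro x hx x' hx'
    refine (convex_closedBall a r).norm_image_sub_le_of_norm_hasFDerivWithin_le'
      (𝕜 := ℂ) (f' := fderiv ℂ (F n)) (fun x hx => ?_) (fun x hx => ?_) hx' hx
    · exact ((h2.differentiableOn (by norm_num)).differentiableAt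
        (hU.mem_nhds (hball (hrr hx)).2)).hasFDerivAt.hasFDerivWithinAt
    · rw [← hA, ← dist_eq_norm]
      exact h1 x (hball (hrr hx)).1
  have hsurj := happ.surjOn_closedBall_of_nonlinearRightInverse A.toNonlinearRightInverse
    hrpos.le subset_rfl
  have hrad : (((A.toNonlinearRightInverse).nnnorm : ℝ)⁻¹ - c) * r = c * r := by
    have : (A.toNonlinearRightInverse).nnnorm = ‖(A.symm : E →L[ℂ] E)‖₊ := rfl
    rw [this, hc]
    push_cast
    ring
  rw [hrad] at hsurj
  have hy' : y ∈ closedBall (F n a) (c * r) := by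
    rw [mem_ball] at hy
    rw [mem_closedBall]
    rw [dist_comm] at h3
    linarith [dist_triangle y (f a) (F n a)]
  obtain ⟨x, hx, hxy⟩ := hsurj hy'
  exact ⟨x, closedBall_subset_closedBall (min_le_right _ _) hx, hxy⟩

end SeveralVariables

/-! ### Derivatives read in charts -/

section Charts

variable {m : ℕ} {M : Type*} [TopologicalSpace M] [ChartedSpace (Cn m) M]

/-- In suitable charts `f` is `v ↦ h.equiv (v, 0)`, an injective linear map, and the derivative of
the domain chart has a left inverse. -/
theorem injective_mfderiv_of_isImmersionAt {N : Type*} [TopologicalSpace N]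
    [ChartedSpace (Cn m) N] [IsManifold 𝓘(ℂ, Cn m) ω N] [IsManifold 𝓘(ℂ, Cn m) ω M]
    {f : N → M} {x : N} (hf : Manifold.IsImmersionAt 𝓘(ℂ, Cn m) 𝓘(ℂ, Cn m) ω f x)
    (hd : MDifferentiableAt 𝓘(ℂ, Cn m) 𝓘(ℂ, Cn m) f x) :
    Function.Injective (mfderiv 𝓘(ℂ, Cn m) 𝓘(ℂ, Cn m) f x) := by
  obtain ⟨F, _, _, h⟩ := hf
  set d := h.domChart with hdd
  set c := h.codChart with hcc
  have hdm : MDifferentiableAt 𝓘(ℂ, Cn m) 𝓘(ℂ, Cn m) d x :=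
    ((contMDiffOn_of_mem_maximalAtlas h.domChart_mem_maximalAtlas).contMDiffAt
      (d.open_source.mem_nhds h.mem_domChart_source)).mdifferentiableAt (by simp)
  have hds : MDifferentiableAt 𝓘(ℂ, Cn m) 𝓘(ℂ, Cn m) d.symm (d x) :=
    ((contMDiffOn_symm_of_mem_maximalAtlas h.domChart_mem_maximalAtlas).contMDiffAt
      (d.open_target.mem_nhds (d.map_source h.mem_domChart_source))).mdifferentiableAt (by simp)
  have hcm : MDifferentiableAt 𝓘(ℂ, Cn m) 𝓘(ℂ, Cn m) c (f x) :=
    ((contMDiffOn_of_mem_maximalAtlas h.codChart_mem_maximalAtlas).contMDiffAt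
      (c.open_source.mem_nhds h.mem_codChart_source)).mdifferentiableAt (by simp)
  set k : Cn m → Cn m := fun v => h.equiv (v, 0) with hk
  have hkd : ∀ y, HasFDerivAt k ((h.equiv : (Cn m × F) →L[ℂ] Cn m) ∘L
      ContinuousLinearMap.inl ℂ (Cn m) F) y := fun y =>
    ((h.equiv : (Cn m × F) →L[ℂ] Cn m) ∘L ContinuousLinearMap.inl ℂ (Cn m) F).hasFDerivAt
  have heq : c ∘ f =ᶠ[𝓝 x] k ∘ d := by
    filter_upwards [d.open_source.mem_nhds h.mem_domChart_source] with y hy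
    have := h.writtenInCharts (show d y ∈ (h.domChart.extend 𝓘(ℂ, Cn m)).target by
      simpa [← hdd] using d.map_source hy)
    simpa [hk, ← hdd, ← hcc, d.left_inv hy] using this
  have h1 : mfderiv 𝓘(ℂ, Cn m) 𝓘(ℂ, Cn m) (c ∘ f) x = _ := heq.mfderiv_eq
  rw [mfderiv_comp x hcm hd, mfderiv_comp x (hkd _).differentiableAt.mdifferentiableAt hdm] at h1
  have h2 : d.symm ∘ d =ᶠ[𝓝 x] id := by
    filter_upwards [d.open_source.mem_nhds h.mem_domChart_source] with y hy
    exact d.left_inv hy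
  have h3 : mfderiv 𝓘(ℂ, Cn m) 𝓘(ℂ, Cn m) (d.symm ∘ d) x = _ := h2.mfderiv_eq
  rw [mfderiv_comp x hds hdm, mfderiv_id] at h3
  rw [mfderiv_eq_fderiv, (hkd _).fderiv] at h1
  intro v v' hv
  have h4 := congrArg (fun L => L v) h1
  have h4' := congrArg (fun L => L v') h1
  have h5 := congrArg (fun L => L v) h3
  have h5' := congrArg (fun L => L v') h3
  have h6 := congrArg (mfderiv 𝓘(ℂ, Cn m) 𝓘(ℂ, Cn m) c (f x)) hv
  have h7 : h.equiv (mfderiv 𝓘(ℂ, Cn m) 𝓘(ℂ, Cn m) d x v, 0) =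
      h.equiv (mfderiv 𝓘(ℂ, Cn m) 𝓘(ℂ, Cn m) d x v', 0) := h4.symm.trans (h6.trans h4')
  have h8 := congrArg Prod.fst (h.equiv.injective h7)
  have h9 := congrArg (mfderiv 𝓘(ℂ, Cn m) 𝓘(ℂ, Cn m) d.symm (d x)) h8
  exact h5.symm.trans (h9.trans h5')

theorem contDiffAt_chart_comp [IsManifold 𝓘(ℂ, Cn m) ω M] {Φ : Cn m → M} {w : Cn m} {p : M}
    (hΦ : ContMDiffAt 𝓘(ℂ, Cn m) 𝓘(ℂ, Cn m) ω Φ w) (hp : Φ w ∈ (chartAt (Cn m) p).source) :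
    ContDiffAt ℂ ω (chartAt (Cn m) p ∘ Φ) w := by
  rw [← contMDiffAt_iff_contDiffAt]
  exact ((contMDiffOn_chart (I := 𝓘(ℂ, Cn m)) (n := ω) (x := p)).contMDiffAt
    ((chartAt (Cn m) p).open_source.mem_nhds hp)).comp w hΦ

/-- The chart is centred at an arbitrary `p`, so that one chart can serve a whole sequence of maps
and its limit. -/
theorem mdifferentiableAt_iff_chart_comp [IsManifold 𝓘(ℂ, Cn m) ω M] {E : Type*}
    [NormedAddCommGroup E] [NormedSpace ℂ E] {Φ : E → M} {w : E} {p : M}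
    (hc : ContinuousAt Φ w) (hp : Φ w ∈ (chartAt (Cn m) p).source) :
    MDifferentiableAt 𝓘(ℂ, E) 𝓘(ℂ, Cn m) Φ w ↔ DifferentiableAt ℂ (chartAt (Cn m) p ∘ Φ) w := by
  set e := chartAt (Cn m) p with he
  have hed : MDifferentiableAt 𝓘(ℂ, Cn m) 𝓘(ℂ, Cn m) e (Φ w) :=
    ((contMDiffOn_chart (I := 𝓘(ℂ, Cn m)) (n := ω) (x := p)).contMDiffAt
      (e.open_source.mem_nhds hp)).mdifferentiableAt (by simp)
  have hes : MDifferentiableAt 𝓘(ℂ, Cn m) 𝓘(ℂ, Cn m) e.symm (e (Φ w)) :=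
    ((contMDiffOn_chart_symm (I := 𝓘(ℂ, Cn m)) (n := ω) (x := p)).contMDiffAt
      (e.open_target.mem_nhds (e.map_source hp))).mdifferentiableAt (by simp)
  rw [← mdifferentiableAt_iff_differentiableAt]
  refine ⟨fun h => hed.comp w h, fun h => ?_⟩
  have h1 : MDifferentiableAt 𝓘(ℂ, E) 𝓘(ℂ, Cn m) (e.symm ∘ (e ∘ Φ)) w := hes.comp w h
  refine h1.congr_of_eventuallyEq ?_
  filter_upwards [hc.preimage_mem_nhds (e.open_source.mem_nhds hp)] with y hy
  exact (e.left_inv hy).symm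

theorem injective_mfderiv_iff_chart_comp [IsManifold 𝓘(ℂ, Cn m) ω M] {Φ : Cn m → M} {w : Cn m}
    {p : M} (hd : MDifferentiableAt 𝓘(ℂ, Cn m) 𝓘(ℂ, Cn m) Φ w)
    (hp : Φ w ∈ (chartAt (Cn m) p).source) :
    Function.Injective (mfderiv 𝓘(ℂ, Cn m) 𝓘(ℂ, Cn m) Φ w) ↔
      Function.Injective (fderiv ℂ (chartAt (Cn m) p ∘ Φ) w) := by
  set e := chartAt (Cn m) p with he
  have hed : MDifferentiableAt 𝓘(ℂ, Cn m) 𝓘(ℂ, Cn m) e (Φ w) :=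
    ((contMDiffOn_chart (I := 𝓘(ℂ, Cn m)) (n := ω) (x := p)).contMDiffAt
      (e.open_source.mem_nhds hp)).mdifferentiableAt (by simp)
  have hes : MDifferentiableAt 𝓘(ℂ, Cn m) 𝓘(ℂ, Cn m) e.symm (e (Φ w)) :=
    ((contMDiffOn_chart_symm (I := 𝓘(ℂ, Cn m)) (n := ω) (x := p)).contMDiffAt
      (e.open_target.mem_nhds (e.map_source hp))).mdifferentiableAt (by simp)
  have h2 : e.symm ∘ e =ᶠ[𝓝 (Φ w)] id := by
    filter_upwards [e.open_source.mem_nhds hp] with y hy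
    exact e.left_inv hy
  have h3 : mfderiv 𝓘(ℂ, Cn m) 𝓘(ℂ, Cn m) (e.symm ∘ e) (Φ w) = _ := h2.mfderiv_eq
  rw [mfderiv_comp _ hes hed, mfderiv_id] at h3
  have h4 : Function.Injective (mfderiv 𝓘(ℂ, Cn m) 𝓘(ℂ, Cn m) e (Φ w)) := by
    intro v v' hv
    have h5 := congrArg (fun L => L v) h3
    have h5' := congrArg (fun L => L v') h3
    have h9 := congrArg (mfderiv 𝓘(ℂ, Cn m) 𝓘(ℂ, Cn m) e.symm (e (Φ w))) hv
    exact h5.symm.trans (h9.trans h5')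
  rw [← mfderiv_eq_fderiv, mfderiv_comp w hed hd]
  exact (h4.of_comp_iff _).symm

theorem isHolomorphicDisc_comp {Φ : Cn m → M} {S : Set (Cn m)}
    (hΦ : ∀ w ∈ S, MDifferentiableAt 𝓘(ℂ, Cn m) 𝓘(ℂ, Cn m) Φ w) {k : ℂ → Cn m}
    (hk : Differentiable ℂ k) (hmaps : MapsTo k unitDisc S) :
    IsHolomorphicDisc m (fun ζ => Φ (k ζ)) := fun ζ hζ =>
  ((hΦ _ (hmaps hζ)).comp ζ (hk ζ).mdifferentiableAt).mdifferentiableWithinAt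

theorem mdifferentiableAt_chart_symm [IsManifold 𝓘(ℂ, Cn m) ω M] (p : M) {x : Cn m}
    (hx : x ∈ (chartAt (Cn m) p).target) :
    MDifferentiableAt 𝓘(ℂ, Cn m) 𝓘(ℂ, Cn m) (chartAt (Cn m) p).symm x :=
  ((contMDiffOn_chart_symm (I := 𝓘(ℂ, Cn m)) (n := ω) (x := p)).contMDiffAt
    ((chartAt (Cn m) p).open_target.mem_nhds hx)).mdifferentiableAt (by simp)

theorem contDiffAt_comp_chart_symm {φ : M → ℝ} (hφ : ContMDiff 𝓘(ℝ, Cn m) 𝓘(ℝ, ℝ) 2 φ) (p : M) :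
    ContDiffAt ℝ 2 (φ ∘ (chartAt (Cn m) p).symm) (chartAt (Cn m) p p) := by
  have := (contMDiffAt_iff.1 (hφ p)).2
  simp only [extChartAt, OpenPartialHomeomorph.extend, modelWithCornersSelf_partialEquiv,
    PartialEquiv.trans_refl, modelWithCornersSelf_coe, range_id, contDiffWithinAt_univ] at this
  exact this

/-- At the minimum `x₀` the derivative vanishes, and it is locally Lipschitz. This supplies the
second-order vanishing that the Schwarz lemma needs. -/
theorem exists_quadratic_bound {E : Type*} [NormedAddCommGroup E] [NormedSpace ℝ E] {g : E → ℝ}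
    {x₀ : E} (hg : ContDiffAt ℝ 2 g x₀) (h0 : g x₀ = 0) (hmin : ∀ᶠ x in 𝓝 x₀, 0 ≤ g x) :
    ∃ C : ℝ, ∀ᶠ x in 𝓝 x₀, g x ≤ C * ‖x - x₀‖ ^ 2 := by
  have hcrit : fderiv ℝ g x₀ = 0 := IsLocalMin.fderiv_eq_zero (by
    filter_upwards [hmin] with x hx
    rw [h0]; exact hx)
  obtain ⟨K, t, ht, hK⟩ := ((hg.fderiv_right (m := 1) (by norm_num)).exists_lipschitzOnWith)
  have hd : ∀ᶠ v in 𝓝 x₀, DifferentiableAt ℝ g v := by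
    filter_upwards [hg.eventually (by norm_num)] with v hv
    exact hv.differentiableAt (by norm_num)
  obtain ⟨r, hr, hball⟩ := Metric.mem_nhds_iff.1 (inter_mem ht hd)
  refine ⟨K, ?_⟩
  filter_upwards [ball_mem_nhds x₀ hr] with x hx
  have hx' : ‖x - x₀‖ < r := by rwa [← dist_eq_norm]
  have hsub : closedBall x₀ ‖x - x₀‖ ⊆ t ∩ {v | DifferentiableAt ℝ g v} :=
    (closedBall_subset_ball hx').trans hball
  have hmv := (convex_closedBall x₀ ‖x - x₀‖).norm_image_sub_le_of_norm_hasFDerivWithin_le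
    (f := g) (f' := fderiv ℝ g) (C := K * ‖x - x₀‖)
    (fun y hy => (hsub hy).2.hasFDerivAt.hasFDerivWithinAt) (fun y hy => by
      have := hK.dist_le_mul y (hsub hy).1 x₀ (hsub (mem_closedBall_self (norm_nonneg _))).1
      rw [dist_eq_norm, hcrit, sub_zero] at this
      exact this.trans (by gcongr; exact hy))
    (mem_closedBall_self (norm_nonneg _)) (show x ∈ _ by rw [mem_closedBall, dist_eq_norm])
  rw [h0, sub_zero] at hmv
  calc g x ≤ ‖g x‖ := Real.le_norm_self _
    _ ≤ _ := hmv
    _ = _ := by ring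

end Charts

/-! ### Upper and lower estimates for squeezing pairs -/

/-- The pair `(Φ, φ)` witnesses that `s` is an admissible weak squeezing bound at `z`. -/
structure IsSqueezingPair (m : ℕ) {M : Type*} [TopologicalSpace M] [ChartedSpace (Cn m) M]
    (z : M) (s : ℝ) (Φ : Cn m → M) (φ : M → ℝ) : Prop where
  embedding : Manifold.IsSmoothEmbedding 𝓘(ℂ, Cn m) 𝓘(ℂ, Cn m) ω (fun w : unitBall m => Φ w)
  smooth : ContMDiff 𝓘(ℝ, Cn m) 𝓘(ℝ, ℝ) 2 φ
  mem_Icc : ∀ p, φ p ∈ Set.Icc (0 : ℝ) 1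
  map_zero : Φ 0 = z
  eq_zero : φ z = 0
  psh : IsPlurisubharmonic m (fun p => ENNReal.log (ENNReal.ofReal (φ p)))
  levi : ∀ w ∈ unitBall m, ∀ X : Cn m, s ^ 2 * ‖X‖ ^ 2 ≤ leviForm (fun v => φ (Φ v)) w X

namespace IsSqueezingPair

variable {m : ℕ} {M : Type*} [TopologicalSpace M] [ChartedSpace (Cn m) M]
  {z : M} {s : ℝ} {Φ : Cn m → M} {φ : M → ℝ}

theorem contMDiffAt (h : IsSqueezingPair m z s Φ φ) {w : Cn m} (hw : w ∈ ball (0 : Cn m) 1) :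
    ContMDiffAt 𝓘(ℂ, Cn m) 𝓘(ℂ, Cn m) ω Φ w :=
  (contMDiffAt_subtype_iff (U := unitBall m) (x := ⟨w, hw⟩)).1 (h.embedding.contMDiff ⟨w, hw⟩)

theorem injOn (h : IsSqueezingPair m z s Φ φ) : InjOn Φ (ball 0 1) := fun a ha b hb hab =>
  congrArg Subtype.val (h.embedding.isEmbedding.injective
    (a₁ := (⟨a, ha⟩ : unitBall m)) (a₂ := ⟨b, hb⟩) hab)

theorem mdifferentiableAt (h : IsSqueezingPair m z s Φ φ) {w : Cn m}
    (hw : w ∈ ball (0 : Cn m) 1) : MDifferentiableAt 𝓘(ℂ, Cn m) 𝓘(ℂ, Cn m) Φ w :=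
  (h.contMDiffAt hw).mdifferentiableAt (by simp)

variable [IsManifold 𝓘(ℂ, Cn m) ω M]

theorem injective_mfderiv (h : IsSqueezingPair m z s Φ φ) {w : Cn m}
    (hw : w ∈ ball (0 : Cn m) 1) :
    Function.Injective (mfderiv 𝓘(ℂ, Cn m) 𝓘(ℂ, Cn m) Φ w) := by
  set x : unitBall m := ⟨w, hw⟩
  have h1 := injective_mfderiv_of_isImmersionAt (h.embedding.isImmersion.isImmersionAt x)
    ((h.embedding.contMDiff x).mdifferentiableAt (by simp))
  have h2 : mfderiv 𝓘(ℂ, Cn m) 𝓘(ℂ, Cn m) (Φ ∘ (Subtype.val : unitBall m → Cn m)) x = _ :=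
    mfderiv_comp x (h.mdifferentiableAt hw)
      ((contMDiff_subtype_val (n := ω) x).mdifferentiableAt (by simp))
  change Function.Injective
    (mfderiv 𝓘(ℂ, Cn m) 𝓘(ℂ, Cn m) (Φ ∘ (Subtype.val : unitBall m → Cn m)) x) at h1
  rw [h2] at h1
  set L : Cn m →L[ℂ] Cn m := mfderiv 𝓘(ℂ, Cn m) 𝓘(ℂ, Cn m) Φ w with hL
  set L' : Cn m →L[ℂ] Cn m := mfderiv 𝓘(ℂ, Cn m) 𝓘(ℂ, Cn m) (Subtype.val : unitBall m → Cn m) x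
  -- Equal finite dimensions: the injective composite is surjective, hence so is `L`, hence `L` is
  -- injective. The derivative of the inclusion need not be computed.
  have h3 : Function.Injective ((L ∘L L' : Cn m →L[ℂ] Cn m) : Cn m →ₗ[ℂ] Cn m) := h1
  have h4 := LinearMap.surjective_of_injective h3
  have h5 : Function.Surjective (L : Cn m →ₗ[ℂ] Cn m) := fun y => by
    obtain ⟨x, hx⟩ := h4 y
    exact ⟨L' x, hx⟩
  have h6 : Function.Injective (L : Cn m →ₗ[ℂ] Cn m) := LinearMap.injective_iff_surjective.2 h5
  exact h6

/-- The Schwarz lemma for holomorphic discs through the base point. -/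
theorem le_norm_sq (h : IsSqueezingPair m z s Φ φ) {f : ℂ → M} (hf : IsHolomorphicDisc m f)
    (hf0 : f 0 = z) {ζ : ℂ} (hζ : ζ ∈ unitDisc) : φ (f ζ) ≤ ‖ζ‖ ^ 2 := by
  set e := chartAt (Cn m) z with he
  have h0D : (0 : ℂ) ∈ unitDisc := by simp [unitDisc]
  have hfc : ContinuousOn f unitDisc := hf.continuousOn
  have hf0c : ContinuousAt f 0 := hfc.continuousAt (isOpen_ball.mem_nhds h0D)
  have hz : f 0 ∈ e.source := by rw [hf0]; exact mem_chart_source _ _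
  have hd : DifferentiableAt ℂ (e ∘ f) 0 := (mdifferentiableAt_iff_chart_comp hf0c hz).1
    ((hf 0 h0D).mdifferentiableAt (isOpen_ball.mem_nhds h0D))
  obtain ⟨C, hC⟩ := exists_quadratic_bound (contDiffAt_comp_chart_symm h.smooth z)
    (by simp [h.eq_zero]) (Eventually.of_forall fun x => (h.mem_Icc _).1)
  obtain ⟨K, hK0, hK⟩ := hd.hasFDerivAt.isBigO_sub.exists_pos
  have hK' := hK.bound
  have hbound : ∀ᶠ ζ in 𝓝 (0 : ℂ), φ (f ζ) ≤ (max C 0 * K ^ 2) * ‖ζ‖ ^ 2 := by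
    have hef : Tendsto (e ∘ f) (𝓝 0) (𝓝 (e z)) := by
      have := hd.continuousAt.tendsto
      rwa [Function.comp_apply, hf0] at this
    filter_upwards [hef.eventually hC, hK', hf0c.preimage_mem_nhds (e.open_source.mem_nhds hz)]
      with ζ h1 h2 h3
    simp only [Function.comp_apply, hf0, sub_zero] at h1 h2
    rw [← he, e.left_inv h3] at h1
    calc φ (f ζ) ≤ C * ‖e (f ζ) - e z‖ ^ 2 := h1
      _ ≤ max C 0 * (K * ‖ζ‖) ^ 2 := by
        gcongr
        exact le_max_left _ _
      _ = _ := by ring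
  exact (h.psh.comp_disc f hf).le_norm_sq (u := fun ζ => φ (f ζ)) (fun ζ _ => (h.mem_Icc _).1)
    (fun ζ _ => (h.mem_Icc _).2) (h.smooth.continuous.comp_continuousOn hfc) hbound hζ

/-- The Schwarz lemma on the disc `ζ ↦ Φ (ζ w / ‖w‖)`, at `ζ = ‖w‖`. -/
theorem apply_le_norm_sq (h : IsSqueezingPair m z s Φ φ) {w : Cn m}
    (hw : w ∈ ball (0 : Cn m) 1) : φ (Φ w) ≤ ‖w‖ ^ 2 := by
  have hn1 : ‖w‖ < 1 := by simpa using hw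
  rcases eq_or_ne w 0 with rfl | hw0
  · simp [h.map_zero, h.eq_zero]
  have hn : 0 < ‖w‖ := norm_pos_iff.2 hw0
  have hu : ‖((‖w‖ : ℂ)⁻¹ • w)‖ = 1 := by
    rw [norm_smul, norm_inv, Complex.norm_real, norm_norm, inv_mul_cancel₀ hn.ne']
  have hdisc : IsHolomorphicDisc m (fun ζ : ℂ => Φ (ζ • ((‖w‖ : ℂ)⁻¹ • w))) := by
    refine isHolomorphicDisc_comp (S := ball 0 1) (fun w hw => h.mdifferentiableAt hw)
      (k := fun ζ : ℂ => ζ • ((‖w‖ : ℂ)⁻¹ • w)) (by fun_prop) fun ζ hζ => ?_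
    rw [mem_ball_zero_iff, norm_smul, hu, mul_one]
    simpa [unitDisc] using hζ
  have := h.le_norm_sq hdisc (by simp [h.map_zero]) (ζ := (‖w‖ : ℂ)) (by simpa [unitDisc] using hn1)
  rwa [smul_smul, mul_inv_cancel₀ (by exact_mod_cast hn.ne'), one_smul, Complex.norm_real,
    norm_norm] at this

/-- The Schwarz lemma on straight discs of radius `ρ` in the chart. The bound depends on the chart
only, hence is uniform over all pairs at `z`. -/
theorem apply_chart_symm_le (h : IsSqueezingPair m z s Φ φ) {ρ : ℝ} (hρ : 0 < ρ)
    (hball : ball (chartAt (Cn m) z z) ρ ⊆ (chartAt (Cn m) z).target) {x : Cn m}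
    (hx : x ∈ ball (chartAt (Cn m) z z) ρ) :
    φ ((chartAt (Cn m) z).symm x) ≤ (‖x - chartAt (Cn m) z z‖ / ρ) ^ 2 := by
  set e := chartAt (Cn m) z with he
  set y := x - e z with hy
  have hxy : x = e z + y := by rw [hy]; abel
  have hyρ : ‖y‖ < ρ := by rwa [mem_ball, dist_eq_norm] at hx
  rcases eq_or_ne y 0 with hy0 | hy0
  · rw [hxy, hy0]
    simp [he, h.eq_zero]
  have hn : 0 < ‖y‖ := norm_pos_iff.2 hy0
  have hdisc : IsHolomorphicDisc m (fun ζ : ℂ => e.symm (e z + ζ • (((ρ / ‖y‖ : ℝ) : ℂ) • y))) := by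
    refine isHolomorphicDisc_comp (S := ball (e z) ρ)
      (fun w hw => mdifferentiableAt_chart_symm z (hball hw))
      (k := fun ζ : ℂ => e z + ζ • (((ρ / ‖y‖ : ℝ) : ℂ) • y)) (by fun_prop) fun ζ hζ => ?_
    have hζ1 : ‖ζ‖ < 1 := by simpa [unitDisc] using hζ
    rw [mem_ball, dist_eq_norm, add_sub_cancel_left, norm_smul, norm_smul, Complex.norm_real,
      Real.norm_of_nonneg (by positivity), div_mul_cancel₀ _ hn.ne']
    nlinarith
  have hlt : ‖y‖ / ρ < 1 := (div_lt_one hρ).2 hyρ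
  have := h.le_norm_sq hdisc (by simp [he]) (ζ := ((‖y‖ / ρ : ℝ) : ℂ)) (by
    rw [unitDisc, mem_ball_zero_iff, Complex.norm_real, Real.norm_of_nonneg (by positivity)]
    exact hlt)
  rw [smul_smul, ← Complex.ofReal_mul, div_mul_div_cancel₀ hρ.ne', div_self hn.ne',
    Complex.ofReal_one, one_smul, ← hxy, Complex.norm_real,
    Real.norm_of_nonneg (by positivity)] at this
  exact this

theorem contDiffOn (h : IsSqueezingPair m z s Φ φ) :
    ContDiffOn ℝ 2 (fun v => φ (Φ v)) (ball 0 1) := by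
  intro w hw
  apply ContDiffAt.contDiffWithinAt
  set e := chartAt (Cn m) (Φ w) with he
  have h1 : ContDiffAt ℝ 2 (e ∘ Φ) w :=
    ((contDiffAt_chart_comp (h.contMDiffAt hw) (mem_chart_source _ _)).restrict_scalars ℝ).of_le
      (by simp)
  have h2 : ContDiffAt ℝ 2 (φ ∘ e.symm) ((e ∘ Φ) w) := contDiffAt_comp_chart_symm h.smooth (Φ w)
  refine (h2.comp w h1).congr_of_eventuallyEq ?_
  filter_upwards [(h.contMDiffAt hw).continuousAt.preimage_mem_nhds
    (e.open_source.mem_nhds (mem_chart_source _ _))] with v hv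
  simp only [Function.comp_apply]
  rw [e.left_inv hv]

theorem le_integral (h : IsSqueezingPair m z s Φ φ) {w : Cn m} (hw : w ∈ ball (0 : Cn m) 1) :
    2 * Real.pi * (s ^ 2 * ‖w‖ ^ 2) ≤
      ∫ θ in (0 : ℝ)..(2 * Real.pi), φ (Φ (Complex.exp (θ * Complex.I) • w)) := by
  have := le_integral_of_leviForm_ge h.contDiffOn h.levi hw
  rwa [h.map_zero, h.eq_zero, zero_add] at this

theorem exp_smul_mem_ball {w : Cn m} (hw : w ∈ ball (0 : Cn m) 1) (θ : ℝ) :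
    Complex.exp (θ * Complex.I) • w ∈ ball (0 : Cn m) 1 := by
  rw [mem_ball_zero_iff, norm_smul, Complex.norm_exp_ofReal_mul_I, one_mul]
  simpa using hw

theorem intervalIntegrable_circle (h : IsSqueezingPair m z s Φ φ) {w : Cn m}
    (hw : w ∈ ball (0 : Cn m) 1) (a b : ℝ) : IntervalIntegrable
      (fun θ : ℝ => φ (Φ (Complex.exp (θ * Complex.I) • w))) MeasureTheory.volume a b := by
  refine Continuous.intervalIntegrable ?_ _ _
  rw [← continuousOn_univ]
  exact h.contDiffOn.continuousOn.comp (f := fun θ : ℝ => Complex.exp (θ * Complex.I) • w)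
    (by fun_prop) fun θ _ => exp_smul_mem_ball hw θ

/-- On each arc of length `ℓ` of the circle through `w`, the function `φ ∘ Φ` comes close to
`s² ‖w‖²`. -/
theorem exists_arc_ge (h : IsSqueezingPair m z s Φ φ) {w : Cn m} (hw : w ∈ ball (0 : Cn m) 1)
    {ℓ : ℝ} (hℓ : 0 < ℓ) (hℓ2 : ℓ ≤ 2 * Real.pi) {b : ℝ}
    (hb : 2 * Real.pi * (1 - s ^ 2) * ‖w‖ ^ 2 < ℓ * (‖w‖ ^ 2 - b)) :
    ∃ θ ∈ Icc 0 ℓ, b ≤ φ (Φ (Complex.exp (θ * Complex.I) • w)) := by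
  -- If `φ ∘ Φ < b` on the arc, the bound `‖w‖ ^ 2` on the rest of the circle leaves a total
  -- integral too small for `le_integral`.
  by_contra! hcon
  have h1 := h.le_integral hw
  rw [← intervalIntegral.integral_add_adjacent_intervals
    (h.intervalIntegrable_circle hw 0 ℓ) (h.intervalIntegrable_circle hw ℓ (2 * Real.pi))] at h1
  have h2 : ∫ θ in (0 : ℝ)..ℓ, φ (Φ (Complex.exp (θ * Complex.I) • w)) ≤ ∫ _ in (0 : ℝ)..ℓ, b :=
    intervalIntegral.integral_mono_on hℓ.le (h.intervalIntegrable_circle hw _ _) (by simp)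
      fun θ hθ => (hcon θ hθ).le
  have h3 : ∫ θ in ℓ..(2 * Real.pi), φ (Φ (Complex.exp (θ * Complex.I) • w)) ≤
      ∫ _ in ℓ..(2 * Real.pi), ‖w‖ ^ 2 :=
    intervalIntegral.integral_mono_on hℓ2 (h.intervalIntegrable_circle hw _ _) (by simp)
      fun θ _ => by
        have := h.apply_le_norm_sq (exp_smul_mem_ball hw θ)
        rwa [norm_smul, Complex.norm_exp_ofReal_mul_I, one_mul] at this
  simp only [intervalIntegral.integral_const, smul_eq_mul] at h2 h3
  nlinarith

end IsSqueezingPair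

/-! ### Tautness and convergence of maps of the ball -/

section NormalFamily

variable {m : ℕ} {M : Type*} [TopologicalSpace M] [ChartedSpace (Cn m) M]

/-- Discs through `z` and the points `Φ n w` cannot diverge compactly because of their centre `z`,
and a convergent subsequence keeps `Φ n w` in a compact set. -/
theorem IsTaut.exists_isCompact_forall_mem [SecondCountableTopology M]
    (hM : IsTaut m M) {z : M} {Φ : ℕ → Cn m → M}
    (hΦ : ∀ n, ∀ w ∈ ball (0 : Cn m) 1, MDifferentiableAt 𝓘(ℂ, Cn m) 𝓘(ℂ, Cn m) (Φ n) w)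
    (h0 : ∀ n, Φ n 0 = z) {w : Cn m} (hw : w ∈ ball (0 : Cn m) 1) :
    ∃ K : Set M, IsCompact K ∧ ∀ n, Φ n w ∈ K := by
  have : LocallyCompactSpace M := ChartedSpace.locallyCompactSpace (Cn m) M
  let E : CompactExhaustion M := default
  by_contra! hcon
  choose N hN using fun j => hcon (E j) (E.isCompact j)
  obtain ⟨r, hwr, hr1⟩ := exists_between (show ‖w‖ < 1 by simpa using hw)
  have hr0 : 0 < r := (norm_nonneg w).trans_lt hwr
  have hdisc : ∀ j, IsHolomorphicDisc m (fun ζ : ℂ => Φ (N j) (ζ • ((r : ℂ)⁻¹ • w))) := by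
    intro j
    refine isHolomorphicDisc_comp (S := ball 0 1) (hΦ (N j))
      (k := fun ζ : ℂ => ζ • ((r : ℂ)⁻¹ • w)) (by fun_prop) fun ζ hζ => ?_
    have hζ1 : ‖ζ‖ < 1 := by simpa [unitDisc] using hζ
    rw [mem_ball_zero_iff, norm_smul, norm_smul, norm_inv, Complex.norm_real,
      Real.norm_of_nonneg hr0.le, ← div_eq_inv_mul]
    have : ‖w‖ / r < 1 := (div_lt_one hr0).2 hwr
    have h' : 0 ≤ ‖w‖ / r := by positivity
    nlinarith [norm_nonneg ζ]
  have hrD : (r : ℂ) ∈ unitDisc := by simpa [unitDisc, abs_of_pos hr0] using hr1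
  have hval : ∀ j, Φ (N j) ((r : ℂ) • ((r : ℂ)⁻¹ • w)) = Φ (N j) w := fun j => by
    rw [smul_smul, mul_inv_cancel₀ (by exact_mod_cast hr0.ne'), one_smul]
  obtain ⟨σ, hσ, ⟨g, -, hg⟩ | hdiv⟩ := hM _ hdisc
  · obtain ⟨J, hJ⟩ := E.exists_mem (g r)
    have hev := hg {(r : ℂ)} (singleton_subset_iff.2 hrD) isCompact_singleton
      (interior (E (J + 1))) isOpen_interior (by
        simpa using E.subset_interior_succ J hJ)
    obtain ⟨n, hn, hnJ⟩ := (hev.and (eventually_ge_atTop (J + 1))).exists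
    have h1 := interior_subset (hn (mem_singleton _))
    simp only [hval] at h1
    exact hN (σ n) (E.subset (hnJ.trans (hσ.id_le n)) h1)
  · obtain ⟨n, hn⟩ := (hdiv {0} (by simp [unitDisc]) isCompact_singleton {z}
      isCompact_singleton).exists
    refine Set.disjoint_left.1 hn (mem_image_of_mem _ (mem_singleton _)) ?_
    simp [h0]

/-- In a taut manifold, holomorphic maps of the ball with a fixed value at the origin converge
continuously along every ultrafilter. -/
theorem IsTaut.exists_tendstoContinuouslyAt [T2Space M] [SecondCountableTopology M]
    (hM : IsTaut m M) {z : M} {Φ : ℕ → Cn m → M}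
    (hΦ : ∀ n, ∀ w ∈ ball (0 : Cn m) 1, MDifferentiableAt 𝓘(ℂ, Cn m) 𝓘(ℂ, Cn m) (Φ n) w)
    (h0 : ∀ n, Φ n 0 = z) (l : Ultrafilter ℕ) :
    ∃ Ψ : Cn m → M, ∀ a ∈ ball (0 : Cn m) 1, TendstoContinuouslyAt l Φ Ψ a := by
  have : LocallyCompactSpace M := ChartedSpace.locallyCompactSpace (Cn m) M
  have hlim : ∀ w, ∃ y, w ∈ ball (0 : Cn m) 1 → Tendsto (fun n => Φ n w) l (𝓝 y) := by
    intro w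
    by_cases hw : w ∈ ball (0 : Cn m) 1
    · obtain ⟨K, hK, hn⟩ := hM.exists_isCompact_forall_mem hΦ h0 hw
      obtain ⟨y, -, hy⟩ := hK.ultrafilter_le_nhds (l.map fun n => Φ n w)
        (le_principal_iff.2 (Filter.mem_map.2 (by
          convert Filter.univ_mem (f := (l : Filter ℕ))
          exact eq_univ_of_forall hn)))
      exact ⟨y, fun _ => hy⟩
    · exact ⟨z, fun h => absurd h hw⟩
  choose Ψ hΨ using hlim
  refine ⟨Ψ, fun a ha => ?_⟩
  rw [TendstoContinuouslyAt]
  intro V hV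
  obtain ⟨V₀, ⟨hV₀, hV₀c⟩, hV₀V⟩ := (closed_nhds_basis (Ψ a)).mem_iff.1
    (isOpen_interior.mem_nhds (mem_interior_iff_mem_nhds.2 hV))
  have ha1 : ‖a‖ < 1 := by simpa using ha
  set ρ := 1 - ‖a‖ with hρ
  have hρ0 : 0 < ρ := by linarith
  have hsub : ball a ρ ⊆ ball 0 1 := ball_subset_ball' (by simp [hρ])
  by_cases hk : ∃ k : ℕ, ∀ᶠ n in (l : Filter ℕ), ∀ w ∈ ball a (ρ / (k + 2)), Φ n w ∈ V
  · obtain ⟨k, hk⟩ := hk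
    have hpos : 0 < ρ / ((k : ℝ) + 2) := by positivity
    rw [Filter.mem_map]
    filter_upwards [hk.prod_mk (ball_mem_nhds a hpos)] with q hq
    exact hq.1 q.2 hq.2
  exfalso
  -- Failure gives points `w k → a` with `Φ (N k) (w k) ∉ V` although `Φ (N k) a ∈ V₀`. The discs
  -- centred at `a` that reach `w k` at the parameter `1 / (k + 2)` would subconverge to some `g`
  -- with `g 0 ∈ V₀`, as `V₀` is closed, so their values at these small parameters would end up in
  -- `V`.
  push Not at hk
  have hch : ∀ k : ℕ, ∃ n, Φ n a ∈ V₀ ∧ ∃ w ∈ ball a (ρ / (k + 2)), Φ n w ∉ V := by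
    intro k
    obtain ⟨n, hn1, hn2⟩ := ((hk k).and ((hΨ a ha) hV₀)).exists
    exact ⟨n, hn2, hn1⟩
  choose N hN w hw hwV using hch
  have hk2 : ∀ k : ℕ, (0 : ℝ) < k + 2 := fun k => by positivity
  have hdisc : ∀ k, IsHolomorphicDisc m
      (fun ζ : ℂ => Φ (N k) (a + ζ • ((((k : ℝ) + 2 : ℝ) : ℂ) • (w k - a)))) := by
    intro k
    refine isHolomorphicDisc_comp (S := ball 0 1) (hΦ (N k))
      (k := fun ζ : ℂ => a + ζ • ((((k : ℝ) + 2 : ℝ) : ℂ) • (w k - a))) (by fun_prop)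
      fun ζ hζ => hsub ?_
    have hζ1 : ‖ζ‖ < 1 := by simpa [unitDisc] using hζ
    have hwk := hw k
    rw [mem_ball, dist_eq_norm, lt_div_iff₀ (hk2 k)] at hwk
    rw [mem_ball, dist_eq_norm, add_sub_cancel_left, norm_smul, norm_smul, Complex.norm_real,
      Real.norm_of_nonneg (hk2 k).le]
    have h3 : 0 ≤ (k + 2) * ‖w k - a‖ := mul_nonneg (hk2 k).le (norm_nonneg _)
    nlinarith [norm_nonneg ζ]
  have hzero : (0 : ℂ) ∈ unitDisc := by simp [unitDisc]
  obtain ⟨σ, hσ, ⟨g, hgd, hg⟩ | hdiv⟩ := hM _ hdisc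
  · have hg0 : g 0 ∈ V₀ := by
      by_contra hcon
      obtain ⟨k, hk⟩ := (hg {0} (singleton_subset_iff.2 hzero) isCompact_singleton V₀ᶜ
        hV₀c.isOpen_compl (by simpa using hcon)).exists
      have := hk (mem_singleton _)
      simp only [zero_smul, add_zero] at this
      exact this (hN _)
    have hgc : ContinuousAt g 0 := hgd.continuousOn.continuousAt (isOpen_ball.mem_nhds hzero)
    obtain ⟨r, hr, hball⟩ := nhds_basis_closedBall.mem_iff.1
      (inter_mem (hgc (isOpen_interior.mem_nhds (hV₀V hg0)))
        ((isOpen_ball (x := (0 : ℂ)) (ε := 1)).mem_nhds hzero))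
    have hev := hg (closedBall 0 r) (fun x hx => (hball hx).2) (isCompact_closedBall _ _)
      (interior V) isOpen_interior fun x hx => (hball hx).1
    obtain ⟨K, hK⟩ := exists_nat_gt (1 / r)
    obtain ⟨k, hk, hkK⟩ := (hev.and (eventually_ge_atTop K)).exists
    have hσk : (K : ℝ) ≤ σ k := by exact_mod_cast hkK.trans (hσ.id_le k)
    have h1 := interior_subset (hk (x := (((σ k : ℝ) + 2)⁻¹ : ℝ)) (by
      rw [mem_closedBall_zero_iff, Complex.norm_real,
        Real.norm_of_nonneg (inv_nonneg.2 (hk2 _).le)]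
      rw [div_lt_iff₀ hr] at hK
      rw [inv_le_iff_one_le_mul₀ (hk2 _)]
      nlinarith))
    simp only at h1
    rw [smul_smul, ← Complex.ofReal_mul, inv_mul_cancel₀ (hk2 _).ne', Complex.ofReal_one,
      one_smul, add_sub_cancel] at h1
    exact hwV _ h1
  · obtain ⟨K, hK, hn⟩ := hM.exists_isCompact_forall_mem hΦ h0 ha
    obtain ⟨n, hn'⟩ := (hdiv {0} (singleton_subset_iff.2 hzero) isCompact_singleton K hK).exists
    refine Set.disjoint_left.1 hn' (mem_image_of_mem _ (mem_singleton _)) ?_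
    simpa using hn (N (σ n))

end NormalFamily

/-! ### The limit map: nonvanishing Jacobian, injectivity, openness -/

theorem differentiable_det {E : Type*} [NormedAddCommGroup E] [NormedSpace ℂ E]
    [FiniteDimensional ℂ E] : Differentiable ℂ fun A : E →L[ℂ] E => A.det := by
  let b := Module.finBasis ℂ E
  have h : ∀ A : E →L[ℂ] E, A.det = ∑ σ : Equiv.Perm (Fin (Module.finrank ℂ E)),
      ((Equiv.Perm.sign σ : ℤ) : ℂ) * ∏ i, b.repr (A (b i)) (σ i) := by
    intro A
    rw [ContinuousLinearMap.det, ← LinearMap.det_toMatrix b, Matrix.det_apply']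
    simp [LinearMap.toMatrix_apply]
  simp_rw [h]
  have hentry : ∀ i j, Differentiable ℂ fun A : E →L[ℂ] E => b.repr (A (b i)) j := fun i j =>
    ((Finsupp.lapply j ∘ₗ b.repr.toLinearMap).toContinuousLinearMap ∘L
      (ContinuousLinearMap.apply ℂ E (b i))).differentiable
  fun_prop

theorem det_ne_zero_iff_injective {E : Type*} [NormedAddCommGroup E] [NormedSpace ℂ E]
    [FiniteDimensional ℂ E] (A : E →L[ℂ] E) : A.det ≠ 0 ↔ Function.Injective A := by
  rw [ContinuousLinearMap.det, Ne, LinearMap.det_eq_zero_iff_ker_ne_bot, not_not,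
    LinearMap.ker_eq_bot]
  rfl

section Limit

variable {m : ℕ} {M : Type*} [TopologicalSpace M] [T2Space M] [ChartedSpace (Cn m) M]
  {z : M} {s : ℕ → ℝ} {Φ : ℕ → Cn m → M} {φ : ℕ → M → ℝ}
  {Ψ : Cn m → M} {l : Ultrafilter ℕ}

theorem continuousAt_limit (hΨ : ∀ a ∈ ball (0 : Cn m) 1, TendstoContinuouslyAt l Φ Ψ a)
    {a : Cn m} (ha : a ∈ ball (0 : Cn m) 1) : ContinuousAt Ψ a := by
  have : LocallyCompactSpace M := ChartedSpace.locallyCompactSpace (Cn m) M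
  refine (hΨ a ha).continuousAt ?_
  filter_upwards [isOpen_ball.mem_nhds ha] with w hw
  exact (hΨ w hw).tendsto

theorem map_zero_limit (hp : ∀ n, IsSqueezingPair m z (s n) (Φ n) (φ n))
    (hΨ : ∀ a ∈ ball (0 : Cn m) 1, TendstoContinuouslyAt l Φ Ψ a) : Ψ 0 = z := by
  have h := (hΨ 0 (by simp)).tendsto
  simp only [(hp _).map_zero] at h
  exact tendsto_nhds_unique h tendsto_const_nhds

variable [IsManifold 𝓘(ℂ, Cn m) ω M]

/-- The convergence `Φ n → Ψ` read in a chart. -/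
theorem exists_chart_limit (hp : ∀ n, IsSqueezingPair m z (s n) (Φ n) (φ n))
    (hΨ : ∀ a ∈ ball (0 : Cn m) 1, TendstoContinuouslyAt l Φ Ψ a)
    {a : Cn m} (ha : a ∈ ball (0 : Cn m) 1) {p : M} (hpa : Ψ a ∈ (chartAt (Cn m) p).source) :
    ∃ r > 0, ball a r ⊆ ball 0 1 ∧ (∀ w ∈ ball a r, Ψ w ∈ (chartAt (Cn m) p).source) ∧
      (∀ᶠ n in l, ∀ w ∈ ball a r, Φ n w ∈ (chartAt (Cn m) p).source) ∧
      (∀ᶠ n in l, ContDiffOn ℂ ω (chartAt (Cn m) p ∘ Φ n) (ball a r)) ∧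
      ∀ w ∈ ball a r, TendstoContinuouslyAt l (fun n => chartAt (Cn m) p ∘ Φ n)
        (chartAt (Cn m) p ∘ Ψ) w := by
  set e := chartAt (Cn m) p with he
  obtain ⟨T, hT, hTn⟩ := (hΨ a ha).eventually_mem (e.open_source.mem_nhds hpa)
  have hc := (continuousAt_limit hΨ ha).preimage_mem_nhds (e.open_source.mem_nhds hpa)
  obtain ⟨r, hr, hball⟩ := Metric.mem_nhds_iff.1
    (inter_mem (inter_mem hT hc) (isOpen_ball.mem_nhds ha))
  have hev : ∀ᶠ n in l, ∀ w ∈ ball a r, Φ n w ∈ e.source :=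
    hTn.mono fun n hn w hw => hn w (hball hw).1.1
  refine ⟨r, hr, fun w hw => (hball hw).2, fun w hw => (hball hw).1.2, hev, ?_, fun w hw => ?_⟩
  · filter_upwards [hev] with n hn w hw
    exact (contDiffAt_chart_comp ((hp n).contMDiffAt (hball hw).2) (hn w hw)).contDiffWithinAt
  · exact (hΨ w (hball hw).2).comp_continuousAt (e.continuousAt (hball hw).1.2)

theorem mdifferentiableAt_limit (hp : ∀ n, IsSqueezingPair m z (s n) (Φ n) (φ n))
    (hΨ : ∀ a ∈ ball (0 : Cn m) 1, TendstoContinuouslyAt l Φ Ψ a)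
    {a : Cn m} (ha : a ∈ ball (0 : Cn m) 1) :
    MDifferentiableAt 𝓘(ℂ, Cn m) 𝓘(ℂ, Cn m) Ψ a := by
  obtain ⟨r, hr, -, -, -, h4, h5⟩ := exists_chart_limit hp hΨ ha (mem_chart_source (Cn m) (Ψ a))
  rw [mdifferentiableAt_iff_chart_comp (continuousAt_limit hΨ ha) (mem_chart_source _ _)]
  exact (hasFDerivAt_limit isOpen_ball (h4.mono fun n hn => hn.of_le (by simp)) h5
    (mem_ball_self hr)).1

theorem injective_mfderiv_limit_zero (hp : ∀ n, IsSqueezingPair m z (s n) (Φ n) (φ n))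
    (hs0 : ∀ n, 0 ≤ s n) (hs : Tendsto s l (𝓝 1))
    (hΨ : ∀ a ∈ ball (0 : Cn m) 1, TendstoContinuouslyAt l Φ Ψ a) :
    Function.Injective (mfderiv 𝓘(ℂ, Cn m) 𝓘(ℂ, Cn m) Ψ 0) := by
  have h0 : (0 : Cn m) ∈ ball (0 : Cn m) 1 := by simp
  have hΨ0 : Ψ 0 = z := map_zero_limit hp hΨ
  have hsrc : Ψ 0 ∈ (chartAt (Cn m) z).source := by rw [hΨ0]; exact mem_chart_source _ _
  rw [injective_mfderiv_iff_chart_comp (mdifferentiableAt_limit hp hΨ h0) hsrc]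
  obtain ⟨r, hr, hr1, -, h3, h4, h5⟩ := exists_chart_limit hp hΨ h0 hsrc
  set e := chartAt (Cn m) z with he
  have hd := (hasFDerivAt_limit isOpen_ball (h4.mono fun n hn => hn.of_le (by simp)) h5
    (mem_ball_self hr)).1
  rw [injective_iff_map_eq_zero]
  intro X hX
  by_contra hX0
  have hXn : 0 < ‖X‖ := norm_pos_iff.2 hX0
  obtain ⟨ρ, hρ, hρt⟩ := Metric.mem_nhds_iff.1
    (e.open_target.mem_nhds (e.map_source (mem_chart_source _ z)))
  -- The error `ρ / 4 * ‖w‖` occurs twice, for linearization and for convergence. Thus `Φ n` maps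
  -- the circle within `ρ * ‖w‖ / 2` of `z` in the chart, so `φ n ∘ Φ n ≤ ‖w‖² / 4` there, and the
  -- lower mean bound gives `s n ≤ 1 / 2`.
  have hlit := hd.hasFDerivAt.isLittleO.bound (show 0 < ρ / 4 by positivity)
  simp only [Function.comp_apply, hΨ0, sub_zero] at hlit
  obtain ⟨δ, hδ, hδb⟩ := Metric.mem_nhds_iff.1 (inter_mem hlit (ball_mem_nhds 0 hr))
  set t : ℝ := min (δ / 2) 1 / ‖X‖ with ht
  have hm0 : 0 < min (δ / 2) 1 := by positivity
  have ht0 : 0 < t := by positivity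
  set w : Cn m := (t : ℂ) • X with hw
  have hwn : ‖w‖ = min (δ / 2) 1 := by
    rw [hw, norm_smul, Complex.norm_real, Real.norm_of_nonneg ht0.le, ht,
      div_mul_cancel₀ _ hXn.ne']
  have hwδ : ‖w‖ < δ := by rw [hwn]; exact (min_le_left _ _).trans_lt (by linarith)
  have hw1 : ‖w‖ ≤ 1 := by rw [hwn]; exact min_le_right _ _
  have hwpos : 0 < ‖w‖ := by rw [hwn]; exact hm0
  have hrot : ∀ θ : ℝ, ‖Complex.exp (θ * Complex.I) • w‖ = ‖w‖ := fun θ => by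
    rw [norm_smul, Complex.norm_exp_ofReal_mul_I, one_mul]
  have hcl : closedBall (0 : Cn m) ‖w‖ ⊆ ball 0 r := fun v hv =>
    (hδb (show v ∈ ball 0 δ by
      rw [mem_ball_zero_iff]; exact (mem_closedBall_zero_iff.1 hv).trans_lt hwδ)).2
  have hwb : w ∈ ball (0 : Cn m) 1 := hr1 (hcl (by simp))
  have hsmall : ∀ θ : ℝ, ‖e (Ψ (Complex.exp (θ * Complex.I) • w)) - e z‖ ≤ ρ / 4 * ‖w‖ := by
    intro θ
    have h := (hδb (show Complex.exp (θ * Complex.I) • w ∈ ball 0 δ by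
      rw [mem_ball_zero_iff, hrot]; exact hwδ)).1
    rw [mem_ofPred_eq, hrot] at h
    have h0 : fderiv ℂ (e ∘ Ψ) 0 (Complex.exp (θ * Complex.I) • w) = 0 := by
      rw [hw, map_smul, map_smul, hX, smul_zero, smul_zero]
    rwa [h0, sub_zero] at h
  have hunif := (tendstoLocallyUniformlyOn_iff_forall_isCompact isOpen_ball).1
    (tendstoLocallyUniformlyOn_of_tendstoContinuouslyAt isOpen_ball h5) _ hcl
    (isCompact_closedBall _ _)
  rw [Metric.tendstoUniformlyOn_iff] at hunif
  have hcontr : ∀ᶠ n in l, s n ≤ 1 / 2 := by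
    filter_upwards [hunif (ρ / 4 * ‖w‖) (by positivity), h3] with n hn hsn
    have hb : ∀ θ : ℝ, φ n (Φ n (Complex.exp (θ * Complex.I) • w)) ≤ (‖w‖ / 2) ^ 2 := by
      intro θ
      set v := Complex.exp (θ * Complex.I) • w with hv
      have hvc : v ∈ closedBall (0 : Cn m) ‖w‖ := by
        rw [mem_closedBall_zero_iff, hrot]
      have e1 := hn v hvc
      rw [dist_comm, dist_eq_norm] at e1
      have e2 := hsmall θ
      have e3 : ‖e (Φ n v) - e z‖ ≤ ρ * (‖w‖ / 2) := by
        calc ‖e (Φ n v) - e z‖ = ‖(e (Φ n v) - e (Ψ v)) + (e (Ψ v) - e z)‖ := by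
              rw [sub_add_sub_cancel]
          _ ≤ _ := norm_add_le _ _
          _ ≤ ρ / 4 * ‖w‖ + ρ / 4 * ‖w‖ := add_le_add e1.le e2
          _ = _ := by ring
      have e4 := (hp n).apply_chart_symm_le hρ hρt (x := e (Φ n v)) (by
        rw [mem_ball, dist_eq_norm]
        nlinarith)
      rw [← he, e.left_inv (hsn v (hcl hvc))] at e4
      refine e4.trans (pow_le_pow_left₀ (by positivity) ?_ 2)
      rw [div_le_iff₀ hρ]
      linarith
    have h1 := (hp n).le_integral hwb
    have h2 : ∫ θ in (0 : ℝ)..(2 * Real.pi), φ n (Φ n (Complex.exp (θ * Complex.I) • w)) ≤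
        ∫ _ in (0 : ℝ)..(2 * Real.pi), (‖w‖ / 2) ^ 2 :=
      intervalIntegral.integral_mono_on (by positivity)
        ((hp n).intervalIntegrable_circle hwb _ _) (by simp) fun θ _ => hb θ
    simp only [intervalIntegral.integral_const, smul_eq_mul, sub_zero] at h2
    have h3 := le_of_mul_le_mul_left (h1.trans h2) (by positivity)
    rw [← mul_pow] at h3
    have h4 := (sq_le_sq₀ (mul_nonneg (hs0 n) hwpos.le) (by positivity)).1 h3
    nlinarith
  have := le_of_tendsto hs hcontr
  norm_num at this

/-- The Jacobians of `Φ n` in a chart have no zeros, so by Hurwitz that of `Ψ` is locally either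
zero-free or identically zero. Hence `S` is open and closed in the connected ball, and it contains
`0`. -/
theorem injective_mfderiv_limit (hp : ∀ n, IsSqueezingPair m z (s n) (Φ n) (φ n))
    (hs0 : ∀ n, 0 ≤ s n) (hs : Tendsto s l (𝓝 1))
    (hΨ : ∀ a ∈ ball (0 : Cn m) 1, TendstoContinuouslyAt l Φ Ψ a)
    {a : Cn m} (ha : a ∈ ball (0 : Cn m) 1) :
    Function.Injective (mfderiv 𝓘(ℂ, Cn m) 𝓘(ℂ, Cn m) Ψ a) := by
  set S : Set (Cn m) := {a | a ∈ ball (0 : Cn m) 1 ∧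
    Function.Injective (mfderiv 𝓘(ℂ, Cn m) 𝓘(ℂ, Cn m) Ψ a)} with hS
  have hloc : ∀ a ∈ ball (0 : Cn m) 1, ∃ r > 0, ball a r ⊆ ball 0 1 ∧
      ((ball a r ∩ S).Nonempty → ball a r ⊆ S) := by
    intro a ha
    obtain ⟨r, hr, hr1, h2, h3, h4, h5⟩ :=
      exists_chart_limit hp hΨ ha (mem_chart_source (Cn m) (Ψ a))
    refine ⟨r, hr, hr1, ?_⟩
    rintro ⟨b, hb, hbS⟩ c hc
    have key : ∀ w ∈ ball a r, (Function.Injective (mfderiv 𝓘(ℂ, Cn m) 𝓘(ℂ, Cn m) Ψ w) ↔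
        (fderiv ℂ (chartAt (Cn m) (Ψ a) ∘ Ψ) w).det ≠ 0) := fun w hw => by
      rw [det_ne_zero_iff_injective, injective_mfderiv_iff_chart_comp
        (mdifferentiableAt_limit hp hΨ (hr1 hw)) (h2 w hw)]
    refine ⟨hr1 hc, (key c hc).2 ?_⟩
    refine ne_zero_of_tendsto_of_ne_zero (l := (l : Filter ℕ)) isOpen_ball (convex_ball a r)
      (J := fun n w => (fderiv ℂ (chartAt (Cn m) (Ψ a) ∘ Φ n) w).det)
      (J₀ := fun w => (fderiv ℂ (chartAt (Cn m) (Ψ a) ∘ Ψ) w).det) ?_ ?_ ?_ hb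
      ((key b hb).1 hbS.2) hc
    · filter_upwards [h4] with n hn
      have h6 : DifferentiableOn ℂ (fderiv ℂ (chartAt (Cn m) (Ψ a) ∘ Φ n)) (ball a r) :=
        (hn.fderiv_of_isOpen (m := 1) isOpen_ball (by simp)).differentiableOn (by norm_num)
      exact (differentiable_det (E := Cn m)).comp_differentiableOn h6
    · filter_upwards [h3] with n hn w hw
      rw [det_ne_zero_iff_injective, ← injective_mfderiv_iff_chart_comp
        ((hp n).mdifferentiableAt (hr1 hw)) (hn w hw)]
      exact (hp n).injective_mfderiv (hr1 hw)
    · intro w hw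
      exact (hasFDerivAt_limit isOpen_ball (h4.mono fun n hn => hn.of_le (by simp)) h5
        hw).2.comp_continuousAt ContinuousLinearMap.continuous_det.continuousAt
  have hopen : IsOpen S := Metric.isOpen_iff.2 fun a ha => by
    obtain ⟨r, hr, -, h⟩ := hloc a ha.1
    exact ⟨r, hr, h ⟨a, mem_ball_self hr, ha⟩⟩
  refine ((convex_ball (0 : Cn m) 1).isPreconnected.subset_of_closure_inter_subset hopen
    ⟨0, by simp, by simp, injective_mfderiv_limit_zero hp hs0 hs hΨ⟩ ?_ ha).2
  rintro b ⟨hb, hb1⟩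
  obtain ⟨r, hr, -, h⟩ := hloc b hb1
  exact h (mem_closure_iff.1 hb _ isOpen_ball (mem_ball_self hr)) (mem_ball_self hr)

/-- The point is that `V` does not depend on `n`: injectivity, openness and the bound near the
closure of the image all rest on it. -/
theorem exists_nhds_subset_image (hp : ∀ n, IsSqueezingPair m z (s n) (Φ n) (φ n))
    (hs0 : ∀ n, 0 ≤ s n) (hs : Tendsto s l (𝓝 1))
    (hΨ : ∀ a ∈ ball (0 : Cn m) 1, TendstoContinuouslyAt l Φ Ψ a)
    {a : Cn m} (ha : a ∈ ball (0 : Cn m) 1) {ε : ℝ} (hε : 0 < ε) :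
    ∃ V ∈ 𝓝 (Ψ a), ∀ᶠ n in l, V ⊆ Φ n '' (closedBall a ε ∩ ball 0 1) := by
  obtain ⟨r, hr, hr1, h2, h3, h4, h5⟩ :=
    exists_chart_limit hp hΨ ha (mem_chart_source (Cn m) (Ψ a))
  set e := chartAt (Cn m) (Ψ a) with he
  have hinj : Function.Injective (fderiv ℂ (e ∘ Ψ) a) := by
    rw [← injective_mfderiv_iff_chart_comp (mdifferentiableAt_limit hp hΨ ha)
      (mem_chart_source _ _)]
    exact injective_mfderiv_limit hp hs0 hs hΨ ha
  let A : Cn m ≃L[ℂ] Cn m := (LinearEquiv.ofInjectiveEndo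
    ((fderiv ℂ (e ∘ Ψ) a : Cn m →L[ℂ] Cn m) : Cn m →ₗ[ℂ] Cn m) hinj).toContinuousLinearEquiv
  have hA : fderiv ℂ (e ∘ Ψ) a = A := by ext v; rfl
  obtain ⟨V, hV, hVn⟩ := exists_nhds_subset_image_closedBall isOpen_ball
    (h4.mono fun n hn => hn.of_le (by simp)) h5 (mem_ball_self hr) A hA
    (show 0 < min ε (r / 2) by positivity)
  refine ⟨e.source ∩ e ⁻¹' V, inter_mem (e.open_source.mem_nhds (mem_chart_source _ _))
    ((e.continuousAt (mem_chart_source _ _)).preimage_mem_nhds hV), ?_⟩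
  filter_upwards [hVn, h3] with n hn hn3
  rintro q ⟨hq, hqV⟩
  obtain ⟨x, hx, hxq⟩ := hn hqV
  have hxr : x ∈ ball a r := closedBall_subset_ball
    ((min_le_right ε (r / 2)).trans_lt (by linarith)) hx
  refine ⟨x, ⟨closedBall_subset_closedBall (min_le_left _ _) hx, hr1 hxr⟩, ?_⟩
  exact e.injOn (hn3 x hxr) hq hxq

/-- A common value at `a` and `b` would be taken by some `Φ n` in two disjoint balls, against
injectivity of `Φ n`. -/
theorem injOn_limit (hp : ∀ n, IsSqueezingPair m z (s n) (Φ n) (φ n))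
    (hs0 : ∀ n, 0 ≤ s n) (hs : Tendsto s l (𝓝 1))
    (hΨ : ∀ a ∈ ball (0 : Cn m) 1, TendstoContinuouslyAt l Φ Ψ a) : InjOn Ψ (ball 0 1) := by
  intro a ha b hb hab
  by_contra hne
  have hd : 0 < dist a b := dist_pos.2 hne
  obtain ⟨V, hV, hVn⟩ := exists_nhds_subset_image hp hs0 hs hΨ ha (ε := dist a b / 3)
    (by positivity)
  obtain ⟨W, hW, hWn⟩ := exists_nhds_subset_image hp hs0 hs hΨ hb (ε := dist a b / 3)
    (by positivity)
  obtain ⟨n, hn1, hn2⟩ := (hVn.and hWn).exists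
  obtain ⟨x, ⟨hx, hx1⟩, hxe⟩ := hn1 (mem_of_mem_nhds hV)
  obtain ⟨y, ⟨hy, hy1⟩, hye⟩ := hn2 (mem_of_mem_nhds hW)
  have hxy : x = y := (hp n).injOn hx1 hy1 (by rw [hxe, hye, hab])
  subst hxy
  rw [mem_closedBall] at hx hy
  linarith [dist_triangle_left a b x]

/-- Preimages of `q` under `Φ n` in the compact ball converge along the ultrafilter, and continuous
convergence sends their limit to `q`. -/
theorem image_closedBall_mem_nhds (hp : ∀ n, IsSqueezingPair m z (s n) (Φ n) (φ n))
    (hs0 : ∀ n, 0 ≤ s n) (hs : Tendsto s l (𝓝 1))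
    (hΨ : ∀ a ∈ ball (0 : Cn m) 1, TendstoContinuouslyAt l Φ Ψ a)
    {a : Cn m} (ha : a ∈ ball (0 : Cn m) 1) {ε : ℝ} (hε : 0 < ε)
    (hε1 : closedBall a ε ⊆ ball 0 1) : Ψ '' closedBall a ε ∈ 𝓝 (Ψ a) := by
  obtain ⟨V, hV, hVn⟩ := exists_nhds_subset_image hp hs0 hs hΨ ha hε
  refine mem_of_superset hV fun q hq => ?_
  have hch : ∀ n, ∃ x ∈ closedBall a ε, V ⊆ Φ n '' (closedBall a ε ∩ ball 0 1) → Φ n x = q := by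
    intro n
    by_cases h : V ⊆ Φ n '' (closedBall a ε ∩ ball 0 1)
    · obtain ⟨x, hx, hxq⟩ := h hq
      exact ⟨x, hx.1, fun _ => hxq⟩
    · exact ⟨a, mem_closedBall_self hε.le, fun h' => absurd h' h⟩
  choose x hx hxq using hch
  obtain ⟨y, hy, hyl⟩ := (isCompact_closedBall a ε).ultrafilter_le_nhds (l.map x)
    (le_principal_iff.2 (Filter.mem_map.2 (by
      convert Filter.univ_mem (f := (l : Filter ℕ))
      exact eq_univ_of_forall hx)))
  refine ⟨y, hy, ?_⟩
  have h1 : Tendsto (fun n => Φ n (x n)) l (𝓝 (Ψ y)) :=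
    (hΨ y (hε1 hy)).comp (tendsto_id.prodMk (show Tendsto x l (𝓝 y) from hyl))
  have h2 : Tendsto (fun n => Φ n (x n)) l (𝓝 q) :=
    tendsto_const_nhds.congr' (hVn.mono fun n hn => (hxq n hn).symm)
  exact tendsto_nhds_unique h1 h2

end Limit

/-! ### Closedness of the image and the biholomorphism -/

section Conclusion

variable {m : ℕ} {M : Type*} [TopologicalSpace M] [ChartedSpace (Cn m) M]
  {z : M} {s : ℕ → ℝ} {Φ : ℕ → Cn m → M} {φ : ℕ → M → ℝ}
  {Ψ : Cn m → M} {l : Ultrafilter ℕ}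

theorem mdifferentiableAt_of_chart_symm {q : M} {F : M → unitBall m} (hF : ContinuousAt F q)
    (hd : DifferentiableAt ℂ ((fun y => (F y : Cn m)) ∘ (chartAt (Cn m) q).symm)
      (chartAt (Cn m) q q)) :
    MDifferentiableAt 𝓘(ℂ, Cn m) 𝓘(ℂ, Cn m) F q := by
  rw [mdifferentiableAt_iff]
  refine ⟨hF, ?_⟩
  exact hd.differentiableWithinAt

variable [IsManifold 𝓘(ℂ, Cn m) ω M]

/-- If `φ ≤ b < 1` near `y₀` in a chart, then `φ` is bounded away from `1` on a whole ball, by a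
bound which does not depend on `φ`. -/
theorem IsSqueezingPair.exists_bound_of_bound_near {p : M} {ρ b η : ℝ} (hρ : 0 < ρ) (hb0 : 0 < b)
    (hb1 : b < 1) (hη : 0 < η)
    (hball : ball (chartAt (Cn m) p p) (5 * ρ) ⊆ (chartAt (Cn m) p).target) {y₀ : Cn m}
    (hy₀ : y₀ ∈ ball (chartAt (Cn m) p p) ρ) :
    ∃ τ < 1, 0 < τ ∧ ∀ {s : ℝ} {Φ : Cn m → M} {φ : M → ℝ}, IsSqueezingPair m z s Φ φ →
      (∀ y ∈ ball y₀ η, φ ((chartAt (Cn m) p).symm y) ≤ b) →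
      ∀ y ∈ ball (chartAt (Cn m) p p) ρ, φ ((chartAt (Cn m) p).symm y) ≤ τ := by
  set e := chartAt (Cn m) p with he
  -- The circle `‖ζ‖ = 1 / 2` in the disc `y + ζ v`, `v = 2 (y₀ - y)`, passes through `y₀` at angle
  -- `0` and stays `η`-close to it for angles in `[0, ℓ]`, since `‖y₀ - y‖ < 2ρ`. There `log φ ≤ log
  -- b`, and elsewhere `log φ ≤ 0`. The disc stays within `ρ + 4ρ` of the chart centre, whence `5 *
  -- ρ`.
  set ℓ := min (η / (4 * ρ)) (2 * Real.pi) with hℓ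
  have hℓ0 : 0 < ℓ := by positivity
  have hlog : Real.log b < 0 := Real.log_neg hb0 hb1
  refine ⟨Real.exp ((2 * Real.pi)⁻¹ * (ℓ * Real.log b)), ?_, Real.exp_pos _, ?_⟩
  · rw [Real.exp_lt_one_iff]
    exact mul_neg_of_pos_of_neg (by positivity) (mul_neg_of_pos_of_neg hℓ0 hlog)
  intro s Φ φ h hφ y hy
  set v : Cn m := (2 : ℂ) • (y₀ - y) with hv
  have hyy : ‖y₀ - y‖ < 2 * ρ := by
    rw [mem_ball] at hy hy₀
    rw [← dist_eq_norm]
    linarith [dist_triangle_right y₀ y (e p)]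
  have hdisc : IsHolomorphicDisc m (fun ζ : ℂ => e.symm (y + ζ • v)) := by
    refine isHolomorphicDisc_comp (S := ball (e p) (5 * ρ))
      (fun w hw => mdifferentiableAt_chart_symm p (hball hw))
      (k := fun ζ : ℂ => y + ζ • v) (by fun_prop) fun ζ hζ => ?_
    have hζ1 : ‖ζ‖ < 1 := by simpa [unitDisc] using hζ
    rw [mem_ball, dist_eq_norm] at hy ⊢
    have h1 : ‖ζ • v‖ ≤ 4 * ρ := by
      rw [norm_smul, hv, norm_smul, Complex.norm_ofNat]
      nlinarith [norm_nonneg ζ, norm_nonneg (y₀ - y)]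
    calc ‖y + ζ • v - e p‖ = ‖(y - e p) + ζ • v‖ := by congr 1; abel
      _ ≤ ‖y - e p‖ + ‖ζ • v‖ := norm_add_le _ _
      _ < 5 * ρ := by linarith
  set k : ℝ → ℝ := (Icc 0 ℓ).indicator fun _ => Real.log b with hk
  have hkint : ∀ a c : ℝ, IntervalIntegrable k MeasureTheory.volume a c := fun a c => by
    have h1 : MeasureTheory.Integrable k :=
      (MeasureTheory.integrable_indicator_iff measurableSet_Icc).2
        (MeasureTheory.integrableOn_const (by simp))
    exact h1.intervalIntegrable
  have hle : ∀ θ, φ (e.symm (y + circleMap 0 (1 / 2) θ • v)) ≤ Real.exp (k θ) := by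
    intro θ
    by_cases hθ : θ ∈ Icc 0 ℓ
    · rw [hk, indicator_of_mem hθ, Real.exp_log hb0]
      apply hφ
      have e1 : y + circleMap 0 (1 / 2) θ • v - y₀ =
          (Complex.exp (θ * Complex.I) - 1) • (y₀ - y) := by
        simp only [circleMap, hv]
        push_cast
        module
      rw [mem_ball, dist_eq_norm, e1, norm_smul]
      have e2 : ‖Complex.exp (θ * Complex.I) - 1‖ ≤ θ := by
        have := Real.norm_exp_I_mul_ofReal_sub_one_le (x := θ)
        rwa [mul_comm, Real.norm_of_nonneg hθ.1] at this
      have e3 : θ * (4 * ρ) ≤ η := (le_div_iff₀ (by positivity)).1 (hθ.2.trans (min_le_left _ _))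
      calc _ ≤ θ * (2 * ρ) := mul_le_mul e2 hyy.le (norm_nonneg _) hθ.1
        _ < η := by linarith
    · rw [hk, indicator_of_notMem hθ, Real.exp_zero]
      exact (h.mem_Icc _).2
  have hfin := (h.psh.comp_disc _ hdisc).le_exp_mean (u := fun ζ => φ (e.symm (y + ζ • v)))
    (fun ζ _ => (h.mem_Icc _).2) (c := 0) (r := 1 / 2) (by norm_num)
    (closedBall_subset_ball (by norm_num)) (hkint _ _) hle
  have hint : ∫ θ in (0 : ℝ)..(2 * Real.pi), k θ = ℓ * Real.log b := by
    rw [← intervalIntegral.integral_add_adjacent_intervals (hkint 0 ℓ) (hkint ℓ (2 * Real.pi))]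
    have e1 : ∫ θ in (0 : ℝ)..ℓ, k θ = ∫ _ in (0 : ℝ)..ℓ, Real.log b :=
      intervalIntegral.integral_congr fun θ hθ => by
        rw [uIcc_of_le hℓ0.le] at hθ
        rw [hk, indicator_of_mem hθ]
    have e2 : ∫ θ in ℓ..(2 * Real.pi), k θ = ∫ _ in ℓ..(2 * Real.pi), (0 : ℝ) :=
      intervalIntegral.integral_congr_ae (Eventually.of_forall fun θ hθ => by
        rw [uIoc_of_le (min_le_right _ _)] at hθ
        rw [hk, indicator_of_notMem fun h => hθ.1.not_ge h.2])
    rw [e1, e2]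
    simp
  rw [hint] at hfin
  simpa using hfin

/-- If `τ < b < ‖w‖²`, a short arc from `w` is mapped by `Φ n` into `W`, where `φ n ≤ τ`; but for `s
n` near `1` that arc carries a point with `φ n ∘ Φ n ≥ b`, by `exists_arc_ge`. -/
theorem norm_sq_le_of_bound (hp : ∀ n, IsSqueezingPair m z (s n) (Φ n) (φ n))
    (hs : Tendsto s l (𝓝 1))
    (hΨ : ∀ a ∈ ball (0 : Cn m) 1, TendstoContinuouslyAt l Φ Ψ a) {τ : ℝ} {W : Set M}
    (hW : ∀ᶠ n in l, ∀ q ∈ W, φ n q ≤ τ) {w : Cn m} (hw : w ∈ ball (0 : Cn m) 1)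
    (hwW : W ∈ 𝓝 (Ψ w)) : ‖w‖ ^ 2 ≤ τ := by
  by_contra! hlt
  obtain ⟨b, hτb, hbw⟩ := exists_between hlt
  obtain ⟨T, hT, hTn⟩ := (hΨ w hw).eventually_mem hwW
  have hc : ContinuousAt (fun θ : ℝ => Complex.exp (θ * Complex.I) • w) 0 := by fun_prop
  have hT' := hc.preimage_mem_nhds (t := T) (by simpa using hT)
  obtain ⟨δ, hδ, hδT⟩ := nhds_basis_closedBall.mem_iff.1 hT'
  set ℓ := min δ (2 * Real.pi) with hℓ
  have hℓ0 : 0 < ℓ := by positivity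
  have hlim : Tendsto (fun n => 2 * Real.pi * (1 - s n ^ 2) * ‖w‖ ^ 2) l (𝓝 0) := by
    have := (((hs.pow 2).const_sub 1).const_mul (2 * Real.pi)).mul_const (‖w‖ ^ 2)
    simpa using this
  have hev := hlim.eventually (gt_mem_nhds (show 0 < ℓ * (‖w‖ ^ 2 - b) from
    mul_pos hℓ0 (sub_pos.2 hbw)))
  obtain ⟨n, hn1, hn2, hn3⟩ := (hev.and (hTn.and hW)).exists
  obtain ⟨θ, hθ, hbθ⟩ := (hp n).exists_arc_ge hw hℓ0 (min_le_right _ _) hn1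
  have := hn3 _ (hn2 _ (hδT (show θ ∈ closedBall (0 : ℝ) δ by
    rw [mem_closedBall_zero_iff, Real.norm_of_nonneg hθ.1]
    exact hθ.2.trans (min_le_left _ _))))
  linarith

variable [T2Space M]

/-- Some `Ψ w₀` lies near `p`. Around it a fixed open set is covered by `Φ n` of a small ball, where
`φ n ≤ (‖w₀‖ + ε)² < 1`; discs in the chart at `p` carry a bound below `1` to a neighbourhood of
`p`. -/
theorem exists_bound_near_closure (hp : ∀ n, IsSqueezingPair m z (s n) (Φ n) (φ n))
    (hs0 : ∀ n, 0 ≤ s n) (hs : Tendsto s l (𝓝 1))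
    (hΨ : ∀ a ∈ ball (0 : Cn m) 1, TendstoContinuouslyAt l Φ Ψ a)
    {p : M} (hcl : p ∈ closure (Ψ '' ball 0 1)) :
    ∃ τ < 1, 0 < τ ∧ ∃ W ∈ 𝓝 p, ∀ᶠ n in l, ∀ q ∈ W, φ n q ≤ τ := by
  set e := chartAt (Cn m) p with he
  have hpe : p ∈ e.source := mem_chart_source _ p
  obtain ⟨R, hR, hRt⟩ := Metric.mem_nhds_iff.1 (e.open_target.mem_nhds (e.map_source hpe))
  set ρ := R / 5 with hρ
  have hρ0 : 0 < ρ := by positivity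
  have hball : ball (e p) (5 * ρ) ⊆ e.target := by
    rwa [hρ, mul_div_cancel₀ _ (by norm_num : (5 : ℝ) ≠ 0)]
  have hW : e.source ∩ e ⁻¹' ball (e p) ρ ∈ 𝓝 p := inter_mem (e.open_source.mem_nhds hpe)
    ((e.continuousAt hpe).preimage_mem_nhds (ball_mem_nhds _ hρ0))
  obtain ⟨-, ⟨hx1, hx2⟩, w₀, hw₀, rfl⟩ := mem_closure_iff_nhds.1 hcl _ hW
  have hw₀1 : ‖w₀‖ < 1 := by simpa using hw₀
  set ε := (1 - ‖w₀‖) / 2 with hε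
  have hε0 : 0 < ε := by rw [hε]; linarith
  obtain ⟨V, hV, hVn⟩ := exists_nhds_subset_image hp hs0 hs hΨ hw₀ hε0
  have hV' : e.symm ⁻¹' V ∈ 𝓝 (e (Ψ w₀)) := by
    refine (e.continuousAt_symm (e.map_source hx1)).preimage_mem_nhds ?_
    rwa [e.left_inv hx1]
  obtain ⟨η, hη, hηV⟩ := Metric.mem_nhds_iff.1 hV'
  have hb0 : 0 < ‖w₀‖ + ε := by positivity
  have hb1 : ‖w₀‖ + ε < 1 := by rw [hε]; linarith
  obtain ⟨τ, hτ1, hτ0, hτ⟩ := IsSqueezingPair.exists_bound_of_bound_near (z := z) hρ0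
    (pow_pos hb0 2) (pow_lt_one₀ hb0.le hb1 two_ne_zero) hη hball hx2
  refine ⟨τ, hτ1, hτ0, _, hW, ?_⟩
  filter_upwards [hVn] with n hn q hq
  have := hτ (hp n) (fun y hy => ?_) (e q) hq.2
  · rwa [e.left_inv hq.1] at this
  · obtain ⟨x, ⟨hx, hxb⟩, hxy⟩ := hn (hηV hy)
    rw [← he, ← hxy]
    refine ((hp n).apply_le_norm_sq hxb).trans ?_
    rw [mem_closedBall, dist_eq_norm] at hx
    gcongr
    calc ‖x‖ = ‖w₀ + (x - w₀)‖ := by congr 1; abel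
      _ ≤ ‖w₀‖ + ‖x - w₀‖ := norm_add_le _ _
      _ ≤ _ := by linarith

/-- Image points near `p` come from the closed ball of radius `√τ < 1`, whose image is compact,
hence closed. -/
theorem isClosed_image_limit (hp : ∀ n, IsSqueezingPair m z (s n) (Φ n) (φ n))
    (hs0 : ∀ n, 0 ≤ s n) (hs : Tendsto s l (𝓝 1))
    (hΨ : ∀ a ∈ ball (0 : Cn m) 1, TendstoContinuouslyAt l Φ Ψ a) :
    IsClosed (Ψ '' ball 0 1) := by
  refine isClosed_of_closure_subset fun p hcl => ?_
  obtain ⟨τ, hτ1, hτ0, W, hW, hWn⟩ := exists_bound_near_closure hp hs0 hs hΨ hcl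
  have hsub : closedBall (0 : Cn m) (Real.sqrt τ) ⊆ ball 0 1 :=
    closedBall_subset_ball ((Real.sqrt_lt' one_pos).2 (by simpa using hτ1))
  have hK : IsCompact (Ψ '' closedBall 0 (Real.sqrt τ)) :=
    (isCompact_closedBall _ _).image_of_continuousOn fun x hx =>
      (continuousAt_limit hΨ (hsub hx)).continuousWithinAt
  refine image_mono hsub (hK.isClosed.closure_subset (mem_closure_iff_nhds.2 fun U hU => ?_))
  obtain ⟨-, ⟨hqU, hqW⟩, w, hw, rfl⟩ := mem_closure_iff_nhds.1 hcl _
    (inter_mem hU (interior_mem_nhds.2 hW))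
  refine ⟨Ψ w, hqU, w, ?_, rfl⟩
  rw [mem_closedBall_zero_iff]
  exact Real.le_sqrt_of_sq_le (norm_sq_le_of_bound hp hs hΨ hWn hw
    (mem_interior_iff_mem_nhds.1 hqW))

theorem isOpen_image_limit (hp : ∀ n, IsSqueezingPair m z (s n) (Φ n) (φ n))
    (hs0 : ∀ n, 0 ≤ s n) (hs : Tendsto s l (𝓝 1))
    (hΨ : ∀ a ∈ ball (0 : Cn m) 1, TendstoContinuouslyAt l Φ Ψ a) :
    IsOpen (Ψ '' ball 0 1) := by
  rw [isOpen_iff_mem_nhds]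
  rintro - ⟨a, ha, rfl⟩
  obtain ⟨ε, hε, hεb⟩ := nhds_basis_closedBall.mem_iff.1 (isOpen_ball.mem_nhds ha)
  exact mem_of_superset (image_closedBall_mem_nhds hp hs0 hs hΨ ha hε hεb) (image_mono hεb)

theorem isBiholomorphicToBall_of_limit [ConnectedSpace M]
    (hp : ∀ n, IsSqueezingPair m z (s n) (Φ n) (φ n))
    (hs0 : ∀ n, 0 ≤ s n) (hs : Tendsto s l (𝓝 1))
    (hΨ : ∀ a ∈ ball (0 : Cn m) 1, TendstoContinuouslyAt l Φ Ψ a) :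
    IsBiholomorphicToBall m M := by
  have hinj := injOn_limit hp hs0 hs hΨ
  have hsurj : Ψ '' ball 0 1 = univ := IsClopen.eq_univ
    ⟨isClosed_image_limit hp hs0 hs hΨ, isOpen_image_limit hp hs0 hs hΨ⟩ ⟨Ψ 0, 0, by simp, rfl⟩
  let G : unitBall m ≃ M := Equiv.ofBijective (fun w : unitBall m => Ψ w)
    ⟨fun a b hab => Subtype.ext (hinj a.2 b.2 hab), fun q => by
      obtain ⟨w, hw, hwq⟩ := hsurj.symm.subset (mem_univ q)
      exact ⟨⟨w, hw⟩, hwq⟩⟩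
  have hGΨ : ∀ w, G w = Ψ w := fun _ => rfl
  refine ⟨G.symm, fun q => ?_, fun w => ?_⟩
  · obtain ⟨⟨a, ha⟩, rfl⟩ := G.surjective q
    have hval : ContinuousAt (fun y => (G.symm y : Cn m)) (G ⟨a, ha⟩) := by
      rw [ContinuousAt, Equiv.symm_apply_apply, nhds_basis_closedBall.tendsto_right_iff]
      intro ε hε
      obtain ⟨δ, hδ, hδb⟩ := nhds_basis_closedBall.mem_iff.1
        (inter_mem (closedBall_mem_nhds a hε) (isOpen_ball.mem_nhds ha))
      filter_upwards [image_closedBall_mem_nhds hp hs0 hs hΨ ha hδ fun x hx => (hδb hx).2]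
      rintro - ⟨x, hx, rfl⟩
      rw [← hGΨ ⟨x, (hδb hx).2⟩, Equiv.symm_apply_apply]
      exact (hδb hx).1
    refine mdifferentiableAt_of_chart_symm (Topology.IsInducing.subtypeVal.continuousAt_iff.2 hval) ?_
    set e := chartAt (Cn m) (G ⟨a, ha⟩) with he
    have hsrc : Ψ a ∈ e.source := mem_chart_source _ (G ⟨a, ha⟩)
    have hd := mdifferentiableAt_limit hp hΨ ha
    have hder := (mdifferentiableAt_iff_chart_comp (continuousAt_limit hΨ ha) hsrc).1 hd
    have hdi := (injective_mfderiv_iff_chart_comp hd hsrc).1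
      (injective_mfderiv_limit hp hs0 hs hΨ ha)
    let A : Cn m ≃L[ℂ] Cn m := (LinearEquiv.ofInjectiveEndo
      ((fderiv ℂ (e ∘ Ψ) a : Cn m →L[ℂ] Cn m) : Cn m →ₗ[ℂ] Cn m) hdi).toContinuousLinearEquiv
    have hA : fderiv ℂ (e ∘ Ψ) a = A := by ext v; rfl
    have htgt : e (G ⟨a, ha⟩) ∈ e.target := e.map_source hsrc
    have hback : e.symm (e (G ⟨a, ha⟩)) = G ⟨a, ha⟩ := e.left_inv hsrc
    refine (HasFDerivAt.of_local_left_inverse (f := e ∘ Ψ) (f' := A) ?_ ?_ ?_).differentiableAt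
    · refine ContinuousAt.comp ?_ (e.continuousAt_symm htgt)
      rwa [hback]
    · rw [Function.comp_apply, hback, Equiv.symm_apply_apply, ← hA]
      exact hder.hasFDerivAt
    · filter_upwards [e.open_target.mem_nhds htgt] with y hy
      simp only [Function.comp_apply]
      rw [← hGΨ, Equiv.apply_symm_apply, e.right_inv hy]
  · exact (mdifferentiableAt_limit hp hΨ w.2).comp w
      ((contMDiff_subtype_val (n := ω) w).mdifferentiableAt (by simp))

end Conclusion

theorem exists_isSqueezingPair_of_weakSqueezing_eq_one {m : ℕ} {M : Type*} [TopologicalSpace M]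
    [ChartedSpace (Cn m) M] {z : M} (hz : weakSqueezing m z = 1) {b : ℝ} (hb : b < 1) :
    ∃ s ∈ Icc b 1, 0 ≤ s ∧ ∃ Φ φ, IsSqueezingPair m z s Φ φ := by
  set S := {s : ℝ | s ∈ Set.Icc (0 : ℝ) 1 ∧ IsWeakSqueezingBound m z s} with hS
  have hsup : sSup S = 1 := hz
  -- The supremum of the empty set is `0`, not `1`.
  have hne : S.Nonempty := by
    by_contra h
    rw [not_nonempty_iff_eq_empty.1 h, Real.sSup_empty] at hsup
    norm_num at hsup
  obtain ⟨s, ⟨hs01, Φ, φ, h1, h2, h3, h4, h5, h6, h7⟩, hbs⟩ :=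
    exists_lt_of_lt_csSup hne (hsup.symm ▸ hb)
  exact ⟨s, ⟨hbs.le, hs01.2⟩, hs01.1, Φ, φ, h1, h2, h3, h4, h5, h6, h7⟩

theorem mainTheorem10 (m : ℕ) (M : Type*) [TopologicalSpace M] [T2Space M]
    [SecondCountableTopology M] [ConnectedSpace M] [ChartedSpace (Cn m) M]
    [IsManifold 𝓘(ℂ, Cn m) ω M]
    (hM : IsTaut m M) (z : M) (hz : weakSqueezing m z = 1) :
    IsBiholomorphicToBall m M := by
  have hb : ∀ n : ℕ, 1 - 1 / ((n : ℝ) + 1) < 1 := fun n => by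
    have : (0 : ℝ) < 1 / ((n : ℝ) + 1) := by positivity
    linarith
  choose s hs hs0 Φ φ hp using fun n => exists_isSqueezingPair_of_weakSqueezing_eq_one hz (hb n)
  have hlim : Tendsto s atTop (𝓝 1) := by
    refine tendsto_of_tendsto_of_tendsto_of_le_of_le ?_ tendsto_const_nhds (fun n => (hs n).1)
      fun n => (hs n).2
    simpa using tendsto_one_div_add_atTop_nhds_zero_nat.const_sub (1 : ℝ)
  obtain ⟨Ψ, hΨ⟩ := hM.exists_tendstoContinuouslyAt (fun n w hw => (hp n).mdifferentiableAt hw)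
    (fun n => (hp n).map_zero) (hyperfilter ℕ)
  exact isBiholomorphicToBall_of_limit hp hs0 (hlim.mono_left Nat.hyperfilter_le_atTop) hΨ
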